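/- Let $n\ge 1$, let $B=\mathbb{C}[X_1,\dots,X_n]$ be graded by giving $X_i$ a positive integer weight $b_i$, and let $f_1,\dots,f_n\in B$ be weighted homogeneous (of weights $a_1,\dots,a_n$). Put $A=\mathbb{C}[f_1,\dots,f_n]\subseteq B$ and assume that $B$ is a finitely generated $A$-module (a finite graded polynomial extension). Let $f=(f_1,\dots,f_n):V=\mathbb{C}^n\to U=\mathbb{C}^n$, let $J=\det(\partial f_i/\partial X_j)$, and let $r$ be the rank of $B$ over $A$. Write $\operatorname{Spec}_1$ for the set of prime ideals of height one. For $\mathfrak q=(Q)\in\operatorname{Spec}_1(B)$, with $\mathfrak q\cap A=(P)$, let the ramification index $e_{\mathfrak q}=e_Q=v_Q(P)$ be the multiplicity of $Q$ in $P$ in $B$; $\mathfrak q$ (or $Q$) is ramified if $e_Q>1$, and $\operatorname{Spec}_1^{\mathrm{ram}}(B)$ is the set of ramified $\mathfrak q\in\operatorname{Spec}_1(B)$. It is finite; choose one generator $Q$ of each of its elements, and write $\prod_Q$ for the product over these generators. Below, $(\prod_Q Q^{e_Q})$ denotes $A\cdot\prod_Q Q^{e_Q}$ (so that equality with an ideal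 of $A$ includes $\prod_Q Q^{e_Q}\in A$), whereas $(J)$ and $(\prod_Q Q)$ are ideals of $B$. Let $V_{\mathrm{ram}}=\{v\in V: J(v)=0\}$ and $U_{\mathrm{branch}}=\{u\in U: |f^{-1}(u)|<r\}$. Then the following are equivalent, whatever the choice of the generators: (i) the extension is well-ramified, i.e. $(J)\cap A=\left(\prod_Q Q^{e_Q}\right)$; (ii) $\left(\prod_Q Q\right)\cap A=\left(\prod_Q Q^{e_Q}\right)$; (iii) $\prod_Q Q^{e_Q}\in A$; (iv) for every $\mathfrak p\in\operatorname{Spec}_1(A)$, if some $\mathfrak q_0\in\operatorname{Spec}_1(B)$ over $\mathfrak p$ is ramified, then every $\mathfrak q\in\operatorname{Spec}_1(B)$ over $\mathfrak p$ is ramified; (v) every irreducible element $P$ of $A$ is, as a polynomial in $B$, either squarefree or such that each of its irreducible factors in $B$ appears with multiplicity at least two; (vi) $f^{-1}(U_{\mathrm{branch}})=V_{\mathrm{ram}}$; (vii) $f(V_{\mathrm{ram}})\cap f(V\setminus V_{\mathrm{ram}})=\varnothing$. -/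

import Mathlib

namespace PolyExt

open MvPolynomial

/-- The subalgebra `A = ℂ[f₁, …, fₙ]` of `B = ℂ[X₁, …, Xₙ]`. -/
noncomputable abbrev baseRing {n : ℕ} (f : Fin n → MvPolynomial (Fin n) ℂ) :
    Subalgebra ℂ (MvPolynomial (Fin n) ℂ) :=
  Algebra.adjoin ℂ (Set.range f)

/-- `ℂ[f₁, …, fₙ] ⊆ ℂ[X₁, …, Xₙ]` is a finite graded polynomial extension: the variable `Xᵢ` has
positive weight `b i`, the polynomial `fᵢ` is weighted homogeneous of weight `a i`, and
`ℂ[X₁, …, Xₙ]` is a module of finite type over `ℂ[f₁, …, fₙ]`. -/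
structure IsFiniteGraded {n : ℕ} (b a : Fin n → ℕ) (f : Fin n → MvPolynomial (Fin n) ℂ) :
    Prop where
  weight_pos : ∀ i, 0 < b i
  homogeneous : ∀ i, IsWeightedHomogeneous b (f i) (a i)
  finite : Module.Finite (baseRing f) (MvPolynomial (Fin n) ℂ)

/-- The mapping `f : ℂⁿ → ℂⁿ`, i.e. the morphism `V = Spec B → U = Spec A` on closed points, where
points of `U` are given by their coordinates `f₁, …, fₙ`. -/
noncomputable def toMap {n : ℕ} (f : Fin n → MvPolynomial (Fin n) ℂ) (x : Fin n → ℂ) : Fin n → ℂ :=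
  fun i => eval x (f i)

/-- The Jacobian determinant `J = det (∂fᵢ / ∂Xⱼ)`. -/
noncomputable def jacobian {n : ℕ} (f : Fin n → MvPolynomial (Fin n) ℂ) : MvPolynomial (Fin n) ℂ :=
  (Matrix.of fun i j => pderiv j (f i)).det

/-- The degree of the extension: the rank `r` of `B` over `A`. -/
noncomputable def degree {n : ℕ} (f : Fin n → MvPolynomial (Fin n) ℂ) : ℕ :=
  Module.finrank (baseRing f) (MvPolynomial (Fin n) ℂ)

/-- The ramification locus in `V = ℂⁿ`: the points where `f` is not étale, i.e. the zeros of the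
Jacobian. -/
def ramLocus {n : ℕ} (f : Fin n → MvPolynomial (Fin n) ℂ) : Set (Fin n → ℂ) :=
  {x | eval x (jacobian f) = 0}

/-- The branch locus in `U = ℂⁿ`: the points whose fibre has fewer than `r` elements. -/
def branchLocus {n : ℕ} (f : Fin n → MvPolynomial (Fin n) ℂ) : Set (Fin n → ℂ) :=
  {u | (toMap f ⁻¹' {u}).encard < (degree f : ℕ∞)}

/-- The set of prime ideals of height one. -/
def specOne (R : Type*) [CommRing R] : Set (Ideal R) :=
  {q | q.IsPrime ∧ q.height = 1}

/-- The ramification index `e(𝔮, 𝔭)` of a height-one prime `𝔮 = (Q)` of `B` over `𝔭 = 𝔮 ∩ A = (P)`: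
the largest `m` with `𝔭 B ⊆ 𝔮 ^ m`, i.e. the multiplicity of `Q` in `P`
(see `ramIndex_eq_multiplicity`). -/
noncomputable def ramIndex {n : ℕ} (f : Fin n → MvPolynomial (Fin n) ℂ)
    (q : Ideal (MvPolynomial (Fin n) ℂ)) : ℕ :=
  Ideal.ramificationIdx' (q.under (baseRing f)) q

theorem ramIndex_eq_multiplicity {n : ℕ} (f : Fin n → MvPolynomial (Fin n) ℂ)
    (Q : MvPolynomial (Fin n) ℂ) (hQ : Irreducible Q) (P : baseRing f) (hP : P ≠ 0)
    (h : (Ideal.span {Q}).under (baseRing f) = Ideal.span {P}) :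
    ramIndex f (Ideal.span {Q}) = multiplicity Q (P : MvPolynomial (Fin n) ℂ) := by
  have hfin : FiniteMultiplicity Q (P : MvPolynomial (Fin n) ℂ) :=
    FiniteMultiplicity.of_not_isUnit hQ.not_isUnit (by simpa using hP)
  have key : ∀ m : ℕ, Ideal.map (algebraMap (baseRing f) (MvPolynomial (Fin n) ℂ))
      (Ideal.span {P}) ≤ Ideal.span {Q} ^ m ↔ Q ^ m ∣ (P : MvPolynomial (Fin n) ℂ) := by
    intro m
    rw [Ideal.map_span, Set.image_singleton, Ideal.span_singleton_pow,
      Ideal.span_singleton_le_span_singleton]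
    rfl
  unfold ramIndex
  rw [h]
  refine Ideal.ramificationIdx'_spec ((key _).2 (pow_multiplicity_dvd _ _)) ?_
  rw [key]
  exact hfin.not_pow_dvd_of_multiplicity_lt (Nat.lt_succ_self _)

/-- The set of ramified height-one primes of `B`. -/
def specOneRam {n : ℕ} (f : Fin n → MvPolynomial (Fin n) ℂ) :
    Set (Ideal (MvPolynomial (Fin n) ℂ)) :=
  {q | q ∈ specOne (MvPolynomial (Fin n) ℂ) ∧ 1 < ramIndex f q}

/-- `g` chooses for every height-one prime of `B` a polynomial generating it, i.e. it is a system
of representatives of the irreducible polynomials up to association. -/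
def IsRepresentatives {n : ℕ}
    (g : Ideal (MvPolynomial (Fin n) ℂ) → MvPolynomial (Fin n) ℂ) : Prop :=
  ∀ q ∈ specOne (MvPolynomial (Fin n) ℂ), Ideal.span {g q} = q

/-- Such systems of representatives exist. -/
theorem exists_isRepresentatives (n : ℕ) :
    ∃ g : Ideal (MvPolynomial (Fin n) ℂ) → MvPolynomial (Fin n) ℂ, IsRepresentatives g := by
  classical
  have H : ∀ q : Ideal (MvPolynomial (Fin n) ℂ), ∃ x, q ∈ specOne (MvPolynomial (Fin n) ℂ) →
      Ideal.span {x} = q := by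
    intro q
    by_cases hq : q ∈ specOne (MvPolynomial (Fin n) ℂ)
    · have := hq.1
      obtain ⟨x, hx, hxp⟩ := Ideal.IsPrime.exists_mem_prime_of_ne_bot hq.1
        (Ideal.ne_bot_of_height_eq_one hq.2)
      exact ⟨x, fun _ => (Ideal.eq_span_singleton_of_height_eq_one hq.2 hx hxp).symm⟩
    · exact ⟨0, fun h => absurd h hq⟩
  choose g hg using H
  exact ⟨g, hg⟩

/-- The product of the ramified polynomials `Q` of `B`. -/
noncomputable def ramProd {n : ℕ} (f : Fin n → MvPolynomial (Fin n) ℂ)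
    (g : Ideal (MvPolynomial (Fin n) ℂ) → MvPolynomial (Fin n) ℂ) : MvPolynomial (Fin n) ℂ :=
  ∏ᶠ q ∈ specOneRam f, g q

/-- The product of the `Q ^ e_Q` over the ramified polynomials `Q` of `B`. -/
noncomputable def ramPowProd {n : ℕ} (f : Fin n → MvPolynomial (Fin n) ℂ)
    (g : Ideal (MvPolynomial (Fin n) ℂ) → MvPolynomial (Fin n) ℂ) : MvPolynomial (Fin n) ℂ :=
  ∏ᶠ q ∈ specOneRam f, g q ^ ramIndex f q

/-- `(F) ∩ A = (R)`, where `(F)` is an ideal of `B` and `(R)` is meant over `A`, i.e. `(R) = A · R`.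
In particular `R` then belongs to `A`, and `(R)` is an ideal of `A`. -/
def ContractsTo {n : ℕ} (f : Fin n → MvPolynomial (Fin n) ℂ) (F R : MvPolynomial (Fin n) ℂ) :
    Prop :=
  (Ideal.span {F} : Set (MvPolynomial (Fin n) ℂ)) ∩ (baseRing f : Set (MvPolynomial (Fin n) ℂ)) =
    (Submodule.span (baseRing f) {R} : Set (MvPolynomial (Fin n) ℂ))

/-- The extension is well-ramified: `(J) ∩ A = (∏ Q ^ e_Q)`. -/
def IsWellRamified {n : ℕ} (f : Fin n → MvPolynomial (Fin n) ℂ)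
    (g : Ideal (MvPolynomial (Fin n) ℂ) → MvPolynomial (Fin n) ℂ) : Prop :=
  ContractsTo f (jacobian f) (ramPowProd f g)

end PolyExt

/-! The `fᵢ` are algebraically independent, so `A` is a polynomial ring, hence factorial and
integrally closed. By going-down, the prime factors in `B` of a prime `P` of `A` are exactly the
generators of the height-one primes over `(P)`.

The arithmetic core is that a prime `Q` of `B` divides `J` iff it is ramified, and that `v_Q(J) <
e_Q` (`dvd_jacobian_of_sq_dvd`, `not_pow_dvd_jacobian`). Both come from the chain rule for `P =
p(f)`; the second also uses that a derivation killing `A` kills everything integral over it. Hence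
`J` and `∏ Q` both divide `R = ∏ Q ^ e_Q` and have all ramified `Q` as factors.

The ramification condition (iv) is the hub. If it holds, the product of the primes of `A` below
ramified ones is `R` up to a constant, and it divides every element of `A` divisible by all ramified
`Q`; this gives (i) and (ii). Each of these puts `R` in `A`, and `R ∈ A` forces (iv), since an
element of `A` divisible by one prime over `(P)` is divisible by all of them.

Geometrically, a fibre has fewer than `r` points iff it meets `J = 0` (`encard_fibre_lt_degree`,
`degree_le_encard_fibre`), so (vi) and (vii) both say that `V_ram` is a union of fibres. Lying-over
and the Nullstellensatz translate this into (iv). -/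

namespace PolyExt
open MvPolynomial

/-! ### Divisibility in factorial rings and derivations of polynomial rings. -/

section Ring

/-- In a unique factorization domain, divisibility can be tested on prime powers. -/
theorem dvd_of_forall_prime_pow_dvd {R : Type*} [CommRing R] [IsDomain R]
    [UniqueFactorizationMonoid R] {a : R} (ha : a ≠ 0) :
    ∀ {b : R}, (∀ q : R, Prime q → ∀ k : ℕ, q ^ k ∣ a → q ^ k ∣ b) → a ∣ b := by
  induction a using UniqueFactorizationMonoid.induction_on_prime with
  | h₁ => exact absurd rfl ha
  | h₂ x hx => exact fun _ => hx.dvd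
  | h₃ a p ha' hp ih =>
    intro b h
    obtain ⟨b', rfl⟩ : p ∣ b := by simpa using h p hp 1 (by simp)
    refine mul_dvd_mul_left p (ih ha' fun q hq k hk => ?_)
    by_cases hpq : p ∣ q
    · obtain ⟨u, hu⟩ := hp.associated_of_dvd hq hpq
      have h1 : q ^ (k + 1) ∣ p * b' := by
        refine h q hq _ ?_
        rw [pow_succ', ← hu]
        rw [← hu] at hk
        exact mul_dvd_mul ((Units.mul_right_dvd).2 dvd_rfl) hk
      rw [pow_succ', ← hu, mul_assoc] at h1
      rw [← hu]
      exact (dvd_mul_left _ _).trans ((mul_dvd_mul_iff_left hp.ne_zero).1 h1)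
    · have hqp : ¬ q ∣ p := fun hd => hpq (hq.associated_of_dvd hp hd).symm.dvd
      have h1 : q ^ k ∣ p * b' := h q hq k (hk.mul_left _)
      exact hq.pow_dvd_of_dvd_mul_left k hqp h1

theorem height_span_singleton_of_prime {R : Type*} [CommRing R] [IsDomain R] [IsNoetherianRing R]
    {x : R} (hx : Prime x) : (Ideal.span {x}).height = 1 :=
  Ideal.height_span_singleton_eq_one_of_mem_nonZeroDivisors
    (mem_nonZeroDivisors_of_ne_zero hx.ne_zero) hx.not_isUnit

theorem span_singleton_mem_specOne {R : Type*} [CommRing R] [IsDomain R] [IsNoetherianRing R]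
    {x : R} (hx : Prime x) : Ideal.span {x} ∈ specOne R :=
  ⟨(Ideal.span_singleton_prime hx.ne_zero).2 hx, height_span_singleton_of_prime hx⟩

theorem exists_prime_span_eq_of_mem_specOne {R : Type*} [CommRing R] [IsDomain R]
    [UniqueFactorizationMonoid R] {p : Ideal R} (hp : p ∈ specOne R) :
    ∃ x, Prime x ∧ p = Ideal.span {x} := by
  have := hp.1
  obtain ⟨x, hx, hxp⟩ := hp.1.exists_mem_prime_of_ne_bot (Ideal.ne_bot_of_height_eq_one hp.2)
  exact ⟨x, hxp, Ideal.eq_span_singleton_of_height_eq_one hp.2 hx hxp⟩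

/-- A nonconstant polynomial over a field of characteristic zero does not divide all of its
partial derivatives. -/
theorem exists_not_dvd_pderiv {σ k : Type*} [Field k] [CharZero k] {p : MvPolynomial σ k}
    (h0 : p ≠ 0) (hu : ¬ IsUnit p) : ∃ i, ¬ p ∣ pderiv i p := by
  classical
  have hdeg : p.totalDegree ≠ 0 := by
    intro h
    rw [totalDegree_eq_zero_iff_eq_C] at h
    rw [h] at hu h0
    exact hu ((IsUnit.mk0 _ fun h' => h0 (by rw [h', C_0])).map C)
  obtain ⟨m, hm, hm0⟩ : ∃ m ∈ p.support, m ≠ 0 := by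
    by_contra! h
    exact hdeg (Nat.le_zero.1 (Finset.sup_le fun m hm => by simp [h m hm]))
  obtain ⟨i, hi⟩ : ∃ i, m i ≠ 0 := by
    by_contra! h
    exact hm0 (Finsupp.ext h)
  refine ⟨i, fun hd => ?_⟩
  -- In characteristic zero the monomial `m` survives differentiation, so the derivative is nonzero
  -- of smaller total degree and cannot be a multiple of `p`.
  have hne : pderiv i p ≠ 0 := by
    intro h
    have h1 := coeff_pderiv (i := i) p (m - Finsupp.single i 1)
    have h2 : m - Finsupp.single i 1 + Finsupp.single i 1 = m :=
      tsub_add_cancel_of_le (by simpa [Nat.one_le_iff_ne_zero] using hi)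
    rw [h, h2, coeff_zero] at h1
    rw [eq_comm, mul_eq_zero] at h1
    rcases h1 with h1 | h1
    · exact (mem_support_iff.1 hm) h1
    · exact Nat.cast_add_one_ne_zero _ h1
  obtain ⟨s, hs⟩ := hd
  have hs0 : s ≠ 0 := fun h => hne (by rw [hs, h, mul_zero])
  have h1 : p.totalDegree ≤ (pderiv i p).totalDegree := by
    rw [hs, totalDegree_mul_of_isDomain h0 hs0]
    exact Nat.le_add_right _ _
  have h2 : (pderiv i p).totalDegree + 1 ≤ p.totalDegree := by
    rw [Nat.add_one_le_iff, totalDegree, Finset.sup_lt_iff (Nat.pos_of_ne_zero hdeg)]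
    intro m' hm'
    have h3 : m' + Finsupp.single i 1 ∈ p.support := by
      rw [mem_support_iff] at hm' ⊢
      intro h
      rw [coeff_pderiv, h, zero_mul] at hm'
      exact hm' rfl
    have h4 := le_totalDegree h3
    rw [Finsupp.sum_add_index' (by simp) (by simp), Finsupp.sum_single_index (by simp)] at h4
    omega
  omega

/-- The chain rule. Values in a module are allowed so that it applies to derivations into `B ⧸ (Q)`.
-/
theorem derivation_aeval {σ τ k M : Type*} [Fintype σ] [CommRing k] [AddCommGroup M] [Module k M]
    [Module (MvPolynomial τ k) M] [IsScalarTower k (MvPolynomial τ k) M]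
    (D : Derivation k (MvPolynomial τ k) M)
    (f : σ → MvPolynomial τ k) (p : MvPolynomial σ k) :
    D (aeval f p) = ∑ i, aeval f (pderiv i p) • D (f i) := by
  classical
  induction p using MvPolynomial.induction_on with
  | C a => simp [algebraMap_eq]
  | add p q hp hq => simp only [map_add, hp, hq, add_smul, Finset.sum_add_distrib]
  | mul_X p j hp =>
    simp only [map_mul, aeval_X, Derivation.leibniz, hp, smul_eq_mul, pderiv_X, map_add, add_smul,
      Finset.sum_add_distrib, Finset.smul_sum, smul_smul]
    congr 1
    rw [Finset.sum_eq_single j]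
    · simp
    · intro i _ hij
      simp [hij.symm]
    · simp

theorem mkDerivation_eq_sum {τ k M : Type*} [Fintype τ] [CommRing k] [AddCommGroup M] [Module k M]
    [Module (MvPolynomial τ k) M] [IsScalarTower k (MvPolynomial τ k) M]
    (w : τ → M) (p : MvPolynomial τ k) :
    mkDerivation k w p = ∑ i, pderiv i p • w i := by
  simpa using derivation_aeval (mkDerivation k w) X p

end Ring

/-- A derivation of `B` with values in a `B`-algebra that is a domain of characteristic zero
vanishes on the elements integral over a subring of constants, provided that it vanishes on the
kernel of the structure map. -/
theorem derivation_eq_zero_of_isIntegral {A B S : Type*} [CommRing A] [CommRing B] [CommRing S]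
    [IsDomain S] [CharZero S] [Algebra A B] [Algebra B S] [Algebra A S] [IsScalarTower A B S]
    (D : Derivation A B S) (hD : ∀ y, algebraMap B S y = 0 → D y = 0) {x : B}
    (hx : IsIntegral A x) : D x = 0 := by
  by_contra hne
  -- If `D x ≠ 0`, applying `D` to a relation `p(x) = 0` in `S` yields `p'(x) = 0`, of lower degree.
  -- Descent excludes all relations nonzero over `S`, in particular the monic one given by
  -- integrality.
  have key : ∀ n : ℕ, ∀ p : Polynomial A, p.natDegree ≤ n → p.map (algebraMap A S) ≠ 0 →
      algebraMap B S (Polynomial.aeval x p) ≠ 0 := by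
    intro n
    induction n with
    | zero =>
      intro p hp hp0 h
      rw [Polynomial.eq_C_of_natDegree_le_zero hp] at hp0 h
      rw [Polynomial.aeval_C, ← IsScalarTower.algebraMap_apply A B S] at h
      rw [Polynomial.map_C, h, Polynomial.C_0] at hp0
      exact hp0 rfl
    | succ n ih =>
      intro p hp hp0 h
      have h1 := hD _ h
      rw [Derivation.map_aeval, Algebra.smul_def, mul_eq_zero] at h1
      have h2 := h1.resolve_right hne
      refine ih p.derivative ((Polynomial.natDegree_derivative_le p).trans (by omega)) ?_ h2
      intro h3
      rw [← Polynomial.derivative_map] at h3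
      have h4 := Polynomial.eq_C_of_derivative_eq_zero h3
      have h5 : Polynomial.aeval (algebraMap B S x) (p.map (algebraMap A S)) = 0 := by
        rw [Polynomial.aeval_map_algebraMap, Polynomial.aeval_algebraMap_apply, h]
      rw [h4, Polynomial.aeval_C, Algebra.algebraMap_self_apply] at h5
      rw [h4, h5, Polynomial.C_0] at hp0
      exact hp0 rfl
  obtain ⟨p, hp, hpx⟩ := hx
  refine key p.natDegree p le_rfl (hp.map _).ne_zero ?_
  rw [Polynomial.aeval_def, hpx, map_zero]

/-! ### The base ring as a polynomial ring, and going-down for height-one primes. -/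

section Setup

variable {n : ℕ} (f : Fin n → MvPolynomial (Fin n) ℂ)

theorem coe_dvd_of_dvd {c d : baseRing f} (h : c ∣ d) :
    (c : MvPolynomial (Fin n) ℂ) ∣ d :=
  map_dvd (algebraMap (baseRing f) (MvPolynomial (Fin n) ℂ)) h

theorem mem_under_span_iff {Q : MvPolynomial (Fin n) ℂ} {c : baseRing f} :
    c ∈ (Ideal.span {Q}).under (baseRing f) ↔ Q ∣ (c : MvPolynomial (Fin n) ℂ) := by
  rw [Ideal.under_def, Ideal.mem_comap, Ideal.mem_span_singleton]
  rfl

variable [Module.Finite (baseRing f) (MvPolynomial (Fin n) ℂ)]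

/-- `B` has transcendence degree `n` and is algebraic over the `n` elements `fᵢ`, which must
therefore form a transcendence basis. -/
theorem algebraicIndependent_of_finite : AlgebraicIndependent ℂ f := by
  refine (Algebra.IsAlgebraic.isTranscendenceBasis_of_lift_le_trdeg_of_finite ℂ f ?_).1
  simp

/-- The base ring is a polynomial ring in `f₁, …, fₙ`. -/
noncomputable def baseEquiv : MvPolynomial (Fin n) ℂ ≃ₐ[ℂ] baseRing f :=
  (algebraicIndependent_of_finite f).aevalEquiv

theorem coe_baseEquiv (p : MvPolynomial (Fin n) ℂ) :
    (baseEquiv f p : MvPolynomial (Fin n) ℂ) = aeval f p :=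
  (algebraicIndependent_of_finite f).algebraMap_aevalEquiv p

instance : UniqueFactorizationMonoid (baseRing f) :=
  (baseEquiv f).toMulEquiv.uniqueFactorizationMonoid inferInstance

instance : IsNoetherianRing (baseRing f) :=
  isNoetherianRing_of_ringEquiv _ (baseEquiv f).toRingEquiv

/-- A height-one prime of `B` containing a prime element `P` of the base ring lies over `(P)`. -/
theorem under_eq_span_of_dvd {Q : MvPolynomial (Fin n) ℂ} (hQ : Prime Q) {P : baseRing f}
    (hP : Prime P) (h : Q ∣ (P : MvPolynomial (Fin n) ℂ)) :
    (Ideal.span {Q}).under (baseRing f) = Ideal.span {P} := by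
  have hQp : (Ideal.span {Q}).IsPrime := (Ideal.span_singleton_prime hQ.ne_zero).2 hQ
  have hPp : (Ideal.span {P}).IsPrime := (Ideal.span_singleton_prime hP.ne_zero).2 hP
  -- Going-down gives a prime `q ⊆ (Q)` over `(P)`. It is nonzero, so it contains a prime element,
  -- necessarily associated to `Q`; thus `q = (Q)`.
  obtain ⟨q, hq, hqp, ⟨hqo⟩⟩ := Ideal.exists_ideal_le_liesOver_of_le (p := Ideal.span {P})
    (q := (Ideal.span {Q}).under (baseRing f)) (Ideal.span {Q})
    ((Ideal.span_singleton_le_iff_mem _).2 ((mem_under_span_iff f).2 h))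
  have hPq : (P : MvPolynomial (Fin n) ℂ) ∈ q := by
    have : P ∈ q.under (baseRing f) := hqo ▸ Ideal.mem_span_singleton_self P
    exact this
  have hq0 : q ≠ ⊥ := by
    rintro rfl
    exact hP.ne_zero (by simpa using hPq)
  obtain ⟨x, hx, hxp⟩ := hqp.exists_mem_prime_of_ne_bot hq0
  have h1 : Q ∣ x := Ideal.mem_span_singleton.1 (hq hx)
  have h2 : Ideal.span {Q} = q := by
    refine le_antisymm ?_ hq
    rw [Ideal.span_singleton_le_iff_mem]
    exact Ideal.mem_of_dvd _ (hQ.associated_of_dvd hxp h1).symm.dvd hx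
  rw [h2, ← hqo]

theorem exists_prime_under_eq_span {Q : MvPolynomial (Fin n) ℂ} (hQ : Prime Q) :
    ∃ P : baseRing f, Prime P ∧ (Ideal.span {Q}).under (baseRing f) = Ideal.span {P} := by
  have hQp : (Ideal.span {Q}).IsPrime := (Ideal.span_singleton_prime hQ.ne_zero).2 hQ
  have hne : (Ideal.span {Q}).under (baseRing f) ≠ ⊥ :=
    Ideal.under_ne_bot _ (by simpa using hQ.ne_zero)
  obtain ⟨P, hP, hPp⟩ := Ideal.IsPrime.exists_mem_prime_of_ne_bot inferInstance hne
  exact ⟨P, hPp, under_eq_span_of_dvd f hQ hPp ((mem_under_span_iff f).1 hP)⟩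

end Setup

/-! ### Multiplicity of a prime in the Jacobian. -/

section Ramification

theorem smul_quotient_span_singleton {R : Type*} [CommRing R] (x : R) (y : R ⧸ Ideal.span {x}) :
    x • y = 0 := by
  obtain ⟨y, rfl⟩ := Ideal.Quotient.mk_surjective y
  exact Ideal.Quotient.eq_zero_iff_mem.2
    (Ideal.mem_span_singleton.2 (dvd_mul_right x y))

variable {n : ℕ} (f : Fin n → MvPolynomial (Fin n) ℂ)

theorem pderiv_aeval_eq (p : MvPolynomial (Fin n) ℂ) (j : Fin n) :
    pderiv j (aeval f p) = ∑ i, aeval f (pderiv i p) * pderiv j (f i) :=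
  derivation_aeval (pderiv j) f p

/-- A tangent vector at the generic point of `Z(Q)` that is killed by the derivatives of the `fᵢ`
and of `Q` is zero, for `B` is integral over the base ring. -/
theorem eq_zero_of_derivation_base_eq_zero [Module.Finite (baseRing f) (MvPolynomial (Fin n) ℂ)]
    {Q : MvPolynomial (Fin n) ℂ} (hQ : Prime Q)
    (D : Derivation ℂ (MvPolynomial (Fin n) ℂ) (MvPolynomial (Fin n) ℂ ⧸ Ideal.span {Q}))
    (hDQ : D Q = 0) (hDf : ∀ i, D (f i) = 0) : D = 0 := by
  have hQp : (Ideal.span {Q}).IsPrime := (Ideal.span_singleton_prime hQ.ne_zero).2 hQ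
  have hDA : ∀ c : baseRing f, D (c : MvPolynomial (Fin n) ℂ) = 0 := by
    rintro ⟨c, hc⟩
    induction hc using Algebra.adjoin_induction with
    | mem x hx =>
      obtain ⟨i, rfl⟩ := hx
      exact hDf i
    | algebraMap r => simp
    | add x y _ _ hx hy => simpa using by rw [hx, hy, add_zero]
    | mul x y _ _ hx hy =>
      change D (x * y) = 0
      rw [Derivation.leibniz, hx, hy, smul_zero, smul_zero, add_zero]
  let D' : Derivation (baseRing f) (MvPolynomial (Fin n) ℂ)
      (MvPolynomial (Fin n) ℂ ⧸ Ideal.span {Q}) :=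
    Derivation.mk'
      { toFun := D
        map_add' := map_add D
        map_smul' := fun c x => by
          rw [RingHom.id_apply, Algebra.smul_def c x, Derivation.leibniz]
          change _ + x • D (c : MvPolynomial (Fin n) ℂ) = _
          rw [hDA, smul_zero, add_zero]
          rfl }
      (fun a b => D.leibniz a b)
  have hchar : CharZero (MvPolynomial (Fin n) ℂ ⧸ Ideal.span {Q}) :=
    charZero_of_injective_algebraMap (algebraMap ℂ _).injective
  refine Derivation.ext fun x => ?_
  refine derivation_eq_zero_of_isIntegral D' (fun y hy => ?_)
    (Algebra.IsIntegral.isIntegral (R := baseRing f) x)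
  obtain ⟨z, rfl⟩ := Ideal.mem_span_singleton.1 (Ideal.Quotient.eq_zero_iff_mem.1 hy)
  change D (Q * z) = 0
  rw [Derivation.leibniz, hDQ, smul_zero, add_zero, smul_quotient_span_singleton]

variable [Module.Finite (baseRing f) (MvPolynomial (Fin n) ℂ)]

/-- For a prime element `P` of the base ring, written as `p(f)`, some partial derivative
`(∂ᵢ p)(f)` does not belong to a given height-one prime of `B` over `(P)`. -/
theorem exists_not_dvd_aeval_pderiv {Q : MvPolynomial (Fin n) ℂ} {P : baseRing f} (hP : Prime P)
    (hQP : (Ideal.span {Q}).under (baseRing f) = Ideal.span {P}) :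
    ∃ p : MvPolynomial (Fin n) ℂ, aeval f p = (P : MvPolynomial (Fin n) ℂ) ∧
      ∃ i, ¬ Q ∣ aeval f (pderiv i p) := by
  have hp : Prime ((baseEquiv f).symm P) := (MulEquiv.prime_iff (baseEquiv f).symm).2 hP
  refine ⟨(baseEquiv f).symm P, by rw [← coe_baseEquiv, AlgEquiv.apply_symm_apply], ?_⟩
  obtain ⟨i, hi⟩ := exists_not_dvd_pderiv hp.ne_zero hp.not_isUnit
  -- If `Q` divides `(∂ᵢ p)(f)`, this element of `A` lies in `(P)`, so `p` divides `∂ᵢ p`.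
  refine ⟨i, fun h => hi ?_⟩
  rw [← coe_baseEquiv, ← mem_under_span_iff, hQP, Ideal.mem_span_singleton] at h
  simpa using map_dvd (baseEquiv f).symm h

/-- If `Q ^ 2` divides `P` then `Q` divides the Jacobian. -/
theorem dvd_jacobian_of_sq_dvd {Q : MvPolynomial (Fin n) ℂ} (hQ : Prime Q) {P : baseRing f}
    (hP : Prime P) (h : Q ^ 2 ∣ (P : MvPolynomial (Fin n) ℂ)) : Q ∣ jacobian f := by
  have hQP := under_eq_span_of_dvd f hQ hP ((dvd_pow_self Q two_ne_zero).trans h)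
  obtain ⟨p, hp, i, hi⟩ := exists_not_dvd_aeval_pderiv f hP hQP
  have hd : ∀ j, Q ∣ ∑ k, aeval f (pderiv k p) * pderiv j (f k) := by
    intro j
    rw [← pderiv_aeval_eq, hp]
    obtain ⟨z, hz⟩ := h
    rw [hz, pderiv_mul, pderiv_pow]
    exact dvd_add ⟨2 * pderiv j Q * z, by push_cast; ring⟩ ⟨Q * pderiv j z, by ring⟩
  set M : Matrix (Fin n) (Fin n) (MvPolynomial (Fin n) ℂ) := Matrix.of fun i j => pderiv j (f i)
    with hM
  -- The new row is the gradient of `P`, zero modulo `Q`; the replacement multiplies the determinant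
  -- by `(∂ᵢ p)(f)`, which is prime to `Q`.
  have h1 : Q ∣ (M.updateRow i (∑ k, aeval f (pderiv k p) • M k)).det := by
    rw [← Ideal.mem_span_singleton, ← Ideal.Quotient.eq_zero_iff_mem, RingHom.map_det]
    refine Matrix.det_eq_zero_of_row_eq_zero i fun j => ?_
    rw [RingHom.mapMatrix_apply, Matrix.map_apply, Matrix.updateRow_self,
      Ideal.Quotient.eq_zero_iff_mem, Ideal.mem_span_singleton]
    simpa [hM] using hd j
  rw [Matrix.det_updateRow_sum, smul_eq_mul] at h1
  exact (hQ.dvd_or_dvd h1).resolve_left hi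

/-- The multiplicity of `Q` in the Jacobian is smaller than its multiplicity in `P`. -/
theorem not_pow_dvd_jacobian {Q : MvPolynomial (Fin n) ℂ} (hQ : Prime Q) {P : baseRing f}
    (hP : Prime P) {e : ℕ} (he : e ≠ 0) (h : Q ^ e ∣ (P : MvPolynomial (Fin n) ℂ))
    (h' : ¬ Q ^ (e + 1) ∣ (P : MvPolynomial (Fin n) ℂ)) : ¬ Q ^ e ∣ jacobian f := by
  have hQp : (Ideal.span {Q}).IsPrime := (Ideal.span_singleton_prime hQ.ne_zero).2 hQ
  have hQP := under_eq_span_of_dvd f hQ hP ((dvd_pow_self Q he).trans h)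
  obtain ⟨p, hp, i, hi⟩ := exists_not_dvd_aeval_pderiv f hP hQP
  obtain ⟨H, hH⟩ := h
  have hQH : ¬ Q ∣ H := fun hd => h' (by rw [hH, pow_succ]; exact mul_dvd_mul_left _ hd)
  obtain ⟨e, rfl⟩ := Nat.exists_eq_succ_of_ne_zero he
  set M : Matrix (Fin n) (Fin n) (MvPolynomial (Fin n) ℂ) := Matrix.of fun i j => pderiv j (f i)
    with hM
  -- The multiplicity is now `e + 1`, and `v` is the gradient of `P = Q ^ (e + 1) * H` divided by `Q
  -- ^ e`.
  let v : Fin n → MvPolynomial (Fin n) ℂ := fun j => (e + 1 : ℕ) * H * pderiv j Q + Q * pderiv j H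
  have hv : Q ^ e • v = ∑ k, aeval f (pderiv k p) • M k := by
    funext j
    have h1 := pderiv_aeval_eq f p j
    rw [hp, hH, pderiv_mul, pderiv_pow] at h1
    simp only [Finset.sum_apply, Pi.smul_apply, smul_eq_mul, hM, Matrix.of_apply]
    rw [← h1]
    simp only [v, Nat.succ_eq_add_one, Nat.add_sub_cancel]
    ring
  have hdet : Q ^ e * (M.updateRow i v).det = aeval f (pderiv i p) * jacobian f := by
    rw [← Matrix.det_updateRow_smul, hv, Matrix.det_updateRow_sum, smul_eq_mul]
    rfl
  intro hJ
  have hQdet : Q ∣ (M.updateRow i v).det := by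
    have h1 : Q ^ e * Q ∣ Q ^ e * (M.updateRow i v).det := by
      rw [hdet, ← pow_succ]
      exact hJ.mul_left _
    exact (mul_dvd_mul_iff_left (pow_ne_zero _ hQ.ne_zero)).1 h1
  let π := Ideal.Quotient.mk (Ideal.span {Q})
  have hπ : ∀ x, π x = 0 ↔ Q ∣ x := fun x => by
    rw [Ideal.Quotient.eq_zero_iff_mem, Ideal.mem_span_singleton]
  have hdet0 : (π.mapMatrix (M.updateRow i v)).det = 0 := by
    rw [← RingHom.map_det, hπ]
    exact hQdet
  -- A kernel vector modulo `Q` defines a derivation into `B ⧸ (Q)`. Its rows other than `i` kill `f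
  -- k`, row `i` kills `Q` (as `Q ∤ H`), and then `D P = 0` kills `f i`; so `D = 0`, against `w ≠
  -- 0`.
  obtain ⟨w, hw0, hw⟩ := Matrix.exists_mulVec_eq_zero_iff.2 hdet0
  let D := mkDerivation ℂ w
  have hD : ∀ x, D x = ∑ j, π (pderiv j x) * w j := fun x => mkDerivation_eq_sum w x
  have hDf : ∀ k, k ≠ i → D (f k) = 0 := by
    intro k hk
    have h1 := congrFun hw k
    simp only [Matrix.mulVec, dotProduct, RingHom.mapMatrix_apply, Matrix.map_apply, ne_eq, hk,
      not_false_eq_true, Matrix.updateRow_ne, hM, Matrix.of_apply, Pi.zero_apply] at h1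
    rw [hD, h1]
  have hQ0 : π Q = 0 := (hπ Q).2 dvd_rfl
  have hDQ : D Q = 0 := by
    have h1 := congrFun hw i
    simp only [Matrix.mulVec, dotProduct, RingHom.mapMatrix_apply, Matrix.map_apply,
      Matrix.updateRow_self, Pi.zero_apply, v, map_add, map_mul, hQ0, zero_mul, add_zero,
      mul_assoc, ← Finset.mul_sum, ← hD] at h1
    have hchar : CharZero (MvPolynomial (Fin n) ℂ ⧸ Ideal.span {Q}) :=
      charZero_of_injective_algebraMap (algebraMap ℂ _).injective
    rw [map_natCast] at h1
    exact ((mul_eq_zero.1 h1).resolve_left (Nat.cast_ne_zero.2 he)|> mul_eq_zero.1).resolve_left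
      fun h2 => hQH ((hπ H).1 h2)
  have hDP : D (aeval f p) = 0 := by
    rw [hp, hH, pow_succ', mul_assoc, Derivation.leibniz, hDQ, smul_zero, add_zero,
      smul_quotient_span_singleton]
  have hDfi : D (f i) = 0 := by
    rw [derivation_aeval, Finset.sum_eq_single i (fun k _ hk => by rw [hDf k hk, smul_zero])
      (by simp)] at hDP
    exact (mul_eq_zero.1 hDP).resolve_left fun h2 => hi ((hπ _).1 h2)
  have hD0 := eq_zero_of_derivation_base_eq_zero f hQ D hDQ fun k => by
    by_cases hk : k = i
    · rw [hk, hDfi]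
    · exact hDf k hk
  refine hw0 (funext fun j => ?_)
  rw [← mkDerivation_X ℂ w j]
  exact congrArg (fun E => E (X j)) hD0

end Ramification

/-! ### Fibres meeting the zero set of the Jacobian. -/

section Fibres

/-- Over an integrally closed domain, `A[x]` is free of rank the degree of the minimal polynomial,
and it sits inside `B`. -/
theorem natDegree_minpoly_le_finrank {A B : Type*} [CommRing A] [IsDomain A] [IsIntegrallyClosed A]
    [CommRing B] [IsDomain B] [Algebra A B] [FaithfulSMul A B] [Module.Finite A B] (x : B) :
    (minpoly A x).natDegree ≤ Module.finrank A B := by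
  have hx : IsIntegral A x := Algebra.IsIntegral.isIntegral x
  rw [← Algebra.adjoin.powerBasis'_dim hx, ← PowerBasis.finrank]
  exact Submodule.finrank_le (Subalgebra.toSubmodule (Algebra.adjoin A {x}))

theorem eval_aeval_eq {n : ℕ} (f : Fin n → MvPolynomial (Fin n) ℂ) (v : Fin n → ℂ)
    (p : MvPolynomial (Fin n) ℂ) : eval v (aeval f p) = eval (toMap f v) p := by
  induction p using MvPolynomial.induction_on with
  | C a => simp [algebraMap_eq]
  | add p q hp hq => simp only [map_add, hp, hq]
  | mul_X p i hp => simp only [map_mul, hp, aeval_X, eval_X, toMap]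

/-- Elements of the base ring are constant on the fibres of `f`. -/
theorem eval_eq_of_toMap_eq {n : ℕ} {f : Fin n → MvPolynomial (Fin n) ℂ} {v v' : Fin n → ℂ}
    (h : toMap f v = toMap f v') (c : baseRing f) :
    eval v (c : MvPolynomial (Fin n) ℂ) = eval v' (c : MvPolynomial (Fin n) ℂ) := by
  have hc : (c : MvPolynomial (Fin n) ℂ) ∈ (aeval (R := ℂ) f).range := by
    rw [← Algebra.adjoin_range_eq_range_aeval]
    exact c.2
  obtain ⟨p, hp⟩ := hc
  rw [← hp]
  change eval v (aeval f p) = eval v' (aeval f p)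
  rw [eval_aeval_eq, eval_aeval_eq, h]

/-- Finitely many nonzero vectors avoid a common linear form. -/
theorem exists_linearForm_ne_zero {n : ℕ} (t : Finset (Fin n → ℂ)) (ht : ∀ d ∈ t, d ≠ 0) :
    ∃ c : Fin n → ℂ, ∀ d ∈ t, ∑ j, c j * d j ≠ 0 := by
  classical
  have hne : ∏ d ∈ t, ∑ j, C (d j) * X j ≠ (0 : MvPolynomial (Fin n) ℂ) := by
    refine Finset.prod_ne_zero_iff.2 fun d hd h0 => ht d hd (funext fun i => ?_)
    have h1 := congrArg (eval (Pi.single i 1)) h0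
    simpa [Pi.single_apply] using h1
  by_contra! h
  refine hne (funext fun c => ?_)
  obtain ⟨d, hd, hd0⟩ := h c
  rw [map_prod, map_zero]
  refine Finset.prod_eq_zero hd ?_
  simpa [mul_comm] using hd0

/-- Finitely many points can be interpolated. -/
theorem exists_eval_eq_ite {n : ℕ} (s : Finset (Fin n → ℂ)) (v : Fin n → ℂ) :
    ∃ p : MvPolynomial (Fin n) ℂ, eval v p = 1 ∧ ∀ v' ∈ s, v' ≠ v → eval v' p = 0 := by
  classical
  have h : ∀ v' : Fin n → ℂ, ∃ p : MvPolynomial (Fin n) ℂ, v' ≠ v → eval v p = 1 ∧ eval v' p = 0 := by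
    intro v'
    by_cases hv : v' = v
    · exact ⟨0, fun h => absurd hv h⟩
    · obtain ⟨j, hj⟩ := Function.ne_iff.1 hv
      refine ⟨C (v j - v' j)⁻¹ * (X j - C (v' j)), fun _ => ⟨?_, by simp⟩⟩
      simp only [map_mul, eval_C, map_sub, eval_X]
      exact inv_mul_cancel₀ (sub_ne_zero.2 (Ne.symm hj))
  choose p hp using h
  refine ⟨∏ v' ∈ s.erase v, p v', ?_, fun v' hv' hne => ?_⟩
  · rw [map_prod]
    exact Finset.prod_eq_one fun v' hv' => (hp v' (Finset.ne_of_mem_erase hv')).1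
  · rw [map_prod]
    exact Finset.prod_eq_zero (Finset.mem_erase.2 ⟨hne, hv'⟩) (hp v' hne).2

theorem eval_aeval_polynomial {n : ℕ} (f : Fin n → MvPolynomial (Fin n) ℂ)
    (v : Fin n → ℂ) (x : MvPolynomial (Fin n) ℂ) (h : Polynomial (baseRing f)) :
    eval v (Polynomial.aeval x h) =
      (h.map ((eval v).comp (algebraMap (baseRing f) (MvPolynomial (Fin n) ℂ)))).eval
        (eval v x) := by
  rw [Polynomial.aeval_def, Polynomial.hom_eval₂, Polynomial.eval_map]

/-- A derivation that at the point `v` vanishes on the `fᵢ` satisfies the chain rule at `v` for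
polynomials over the base ring. -/
theorem eval_derivation_aeval {n : ℕ} {f : Fin n → MvPolynomial (Fin n) ℂ} {v : Fin n → ℂ}
    (D : Derivation ℂ (MvPolynomial (Fin n) ℂ) (MvPolynomial (Fin n) ℂ))
    (hD : ∀ i, eval v (D (f i)) = 0) (x : MvPolynomial (Fin n) ℂ) (h : Polynomial (baseRing f)) :
    eval v (D (Polynomial.aeval x h)) =
      eval v (Polynomial.aeval x (Polynomial.derivative h)) * eval v (D x) := by
  have hDA : ∀ c : baseRing f, eval v (D c) = 0 := by
    rintro ⟨c, hc⟩
    induction hc using Algebra.adjoin_induction with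
    | mem x hx =>
      obtain ⟨i, rfl⟩ := hx
      exact hD i
    | algebraMap r => simp
    | add x y _ _ hx hy => simpa using by rw [hx, hy, add_zero]
    | mul x y _ _ hx hy =>
      change eval v (D (x * y)) = 0
      change eval v (D x) = 0 at hx
      change eval v (D y) = 0 at hy
      rw [Derivation.leibniz, map_add, smul_eq_mul, smul_eq_mul, map_mul, map_mul, hx, hy,
        mul_zero, mul_zero, add_zero]
  induction h using Polynomial.induction_on' with
  | add p q hp hq => simp only [map_add, hp, hq, add_mul]
  | monomial k c =>
    have hc : algebraMap (baseRing f) (MvPolynomial (Fin n) ℂ) c = c := rfl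
    rw [Polynomial.derivative_monomial, Polynomial.aeval_monomial, Polynomial.aeval_monomial,
      Derivation.leibniz, Derivation.leibniz_pow, map_add, hc]
    simp only [smul_eq_mul, nsmul_eq_mul, map_mul, hDA, mul_zero, add_zero, map_natCast, hc]
    ring

variable {n : ℕ} (f : Fin n → MvPolynomial (Fin n) ℂ)

theorem exists_ne_zero_of_eval_jacobian_eq_zero {v : Fin n → ℂ} (h : eval v (jacobian f) = 0) :
    ∃ w : Fin n → ℂ, w ≠ 0 ∧ ∀ i, ∑ j, eval v (pderiv j (f i)) * w j = 0 := by
  rw [jacobian, RingHom.map_det] at h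
  obtain ⟨w, hw0, hw⟩ := Matrix.exists_mulVec_eq_zero_iff.2 h
  exact ⟨w, hw0, fun i => congrFun hw i⟩

variable [Module.Finite (baseRing f) (MvPolynomial (Fin n) ℂ)]

/-- The fibre through a zero of the Jacobian has fewer than `r` points. -/
theorem encard_fibre_lt_degree {v₀ : Fin n → ℂ} (h : eval v₀ (jacobian f) = 0) :
    (toMap f ⁻¹' {toMap f v₀}).encard < (degree f : ℕ∞) := by
  classical
  by_contra! hle
  obtain ⟨w, hw0, hw⟩ := exists_ne_zero_of_eval_jacobian_eq_zero f h
  obtain ⟨t, ht, htc⟩ := Set.exists_subset_encard_eq hle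
  have htf : t.Finite := Set.finite_of_encard_eq_coe htc
  lift t to Finset (Fin n → ℂ) using htf
  rw [Set.encard_coe_eq_coe_finsetCard, Nat.cast_inj] at htc
  -- The `r` chosen points of the fibre need not include `v₀`.
  let s := insert v₀ t
  have hs : ∀ v ∈ s, toMap f v = toMap f v₀ := by
    intro v hv
    rcases Finset.mem_insert.1 hv with rfl | hv
    · rfl
    · exact ht hv
  have hsc : degree f ≤ s.card := htc ▸ Finset.card_le_card (Finset.subset_insert _ _)
  -- The form separates the points of `s` and is nonzero on the tangent vector `w` killed by the
  -- Jacobian matrix at `v₀`.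
  obtain ⟨c, hc⟩ := exists_linearForm_ne_zero
    (insert w (((s ×ˢ s).filter fun p => p.1 ≠ p.2).image fun p => p.1 - p.2)) (by
      intro d hd
      rcases Finset.mem_insert.1 hd with rfl | hd
      · exact hw0
      · obtain ⟨p, hp, rfl⟩ := Finset.mem_image.1 hd
        exact sub_ne_zero.2 (Finset.mem_filter.1 hp).2)
  let ℓ : MvPolynomial (Fin n) ℂ := ∑ j, C (c j) * X j
  have hℓ : ∀ v, eval v ℓ = ∑ j, c j * v j := fun v => by simp [ℓ]
  have hinj : Set.InjOn (fun v => eval v ℓ) (s : Set (Fin n → ℂ)) := by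
    intro v hv v' hv' hvv
    by_contra hne
    refine hc (v - v') (Finset.mem_insert_of_mem (Finset.mem_image.2 ⟨(v, v'), ?_, rfl⟩)) ?_
    · exact Finset.mem_filter.2 ⟨Finset.mem_product.2 ⟨hv, hv'⟩, hne⟩
    · simp only [hℓ] at hvv
      simp [mul_sub, hvv]
  set ε := (eval v₀).comp (algebraMap (baseRing f) (MvPolynomial (Fin n) ℂ)) with hε
  have hεs : ∀ v ∈ s, (eval v).comp (algebraMap (baseRing f) (MvPolynomial (Fin n) ℂ)) = ε :=
    fun v hv => RingHom.ext fun a => eval_eq_of_toMap_eq (hs v hv) a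
  set p := minpoly (baseRing f) ℓ with hp
  have hpm : p.Monic := minpoly.monic (Algebra.IsIntegral.isIntegral ℓ)
  have hp0 : p.map ε ≠ 0 := (hpm.map ε).ne_zero
  have hroot : s.image (fun v => eval v ℓ) ⊆ (p.map ε).roots.toFinset := by
    intro a ha
    obtain ⟨v, hv, rfl⟩ := Finset.mem_image.1 ha
    rw [Multiset.mem_toFinset, Polynomial.mem_roots hp0, Polynomial.IsRoot, ← hεs v hv,
      ← eval_aeval_polynomial, minpoly.aeval, map_zero]
  -- The specialised minimal polynomial has degree at most `r` and at least `r` distinct roots, so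
  -- all its roots are simple.
  have hnodup : (p.map ε).roots.Nodup := by
    rw [← Multiset.toFinset_card_eq_card_iff_nodup]
    refine le_antisymm (Multiset.toFinset_card_le _) ?_
    calc (p.map ε).roots.card ≤ (p.map ε).natDegree := Polynomial.card_roots' _
      _ = p.natDegree := hpm.natDegree_map ε
      _ ≤ degree f := natDegree_minpoly_le_finrank ℓ
      _ ≤ s.card := hsc
      _ = (s.image fun v => eval v ℓ).card := (Finset.card_image_of_injOn hinj).symm
      _ ≤ _ := Finset.card_le_card hroot
  have hv₀ : v₀ ∈ s := Finset.mem_insert_self _ _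
  have hr₀ : (p.map ε).IsRoot (eval v₀ ℓ) := (Polynomial.mem_roots hp0).1
    (Multiset.mem_toFinset.1 (hroot (Finset.mem_image_of_mem _ hv₀)))
  have hder : (Polynomial.derivative (p.map ε)).eval (eval v₀ ℓ) ≠ 0 := by
    intro hd
    have h1 := (Polynomial.one_lt_rootMultiplicity_iff_isRoot hp0).2 ⟨hr₀, hd⟩
    rw [← Polynomial.count_roots] at h1
    exact absurd (Multiset.nodup_iff_count_le_one.1 hnodup (eval v₀ ℓ)) (not_le.2 h1)
  -- Differentiating `p(ℓ) = 0` along `w` at `v₀` gives `p'(ℓ(v₀)) · ℓ(w) = 0`, where neither factor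
  -- vanishes.
  let D := mkDerivation ℂ (fun j => (C (w j) : MvPolynomial (Fin n) ℂ))
  have hD : ∀ x, eval v₀ (D x) = ∑ j, eval v₀ (pderiv j x) * w j := fun x => by
    simp [D, mkDerivation_eq_sum]
  have h1 := eval_derivation_aeval D (fun i => by rw [hD, hw i]) ℓ p
  rw [minpoly.aeval, map_zero, map_zero, eval_aeval_polynomial, ← Polynomial.derivative_map] at h1
  have h2 := (mul_eq_zero.1 h1.symm).resolve_left hder
  refine hc w (Finset.mem_insert_self _ _) ?_
  simpa [D, ℓ, mkDerivation_X, MvPolynomial.derivation_C_mul] using h2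

end Fibres

/-! ### Fibres avoiding the zero set of the Jacobian. -/

section EtaleFibres

variable {n : ℕ}

/-- The maximal ideal of the point `v`. -/
noncomputable abbrev pointIdeal (v : Fin n → ℂ) : Ideal (MvPolynomial (Fin n) ℂ) :=
  vanishingIdeal ℂ ({v} : Set (Fin n → ℂ))

theorem mem_pointIdeal {v : Fin n → ℂ} {p : MvPolynomial (Fin n) ℂ} :
    p ∈ pointIdeal v ↔ eval v p = 0 := by
  rw [mem_vanishingIdeal_singleton_iff, aeval_eq_eval]

theorem X_sub_C_mem_pointIdeal (v : Fin n → ℂ) (j : Fin n) : X j - C (v j) ∈ pointIdeal v := by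
  simp

/-- The Taylor expansion to first order. -/
theorem sub_linear_mem_pointIdeal_sq (v : Fin n → ℂ) (p : MvPolynomial (Fin n) ℂ) :
    p - C (eval v p) - ∑ j, C (eval v (pderiv j p)) * (X j - C (v j)) ∈ pointIdeal v ^ 2 := by
  classical
  induction p using MvPolynomial.induction_on with
  | C a => simp
  | add p q hp hq =>
    convert add_mem hp hq using 1
    simp only [map_add, add_mul, Finset.sum_add_distrib]
    ring
  | mul_X p i hp =>
    have h1 : (p - C (eval v p)) * (X i - C (v i)) ∈ pointIdeal v ^ 2 := by
      rw [pow_two]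
      exact Ideal.mul_mem_mul (mem_pointIdeal.2 (by simp)) (X_sub_C_mem_pointIdeal v i)
    convert add_mem (Ideal.mul_mem_left _ (C (v i)) hp) h1 using 1
    have h2 : ∑ j, C (eval v (pderiv j (p * X i))) * (X j - C (v j)) =
        C (v i) * ∑ j, C (eval v (pderiv j p)) * (X j - C (v j)) +
          C (eval v p) * (X i - C (v i)) := by
      simp only [pderiv_mul, map_add, map_mul, eval_X, add_mul, Finset.sum_add_distrib,
        Finset.mul_sum]
      congr 1
      · exact Finset.sum_congr rfl fun j _ => by ring
      · rw [Finset.sum_eq_single i]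
        · simp
        · intro j _ hj
          simp [pderiv_X_of_ne hj.symm]
        · simp
    rw [h2]
    simp only [map_mul, eval_X]
    ring

variable (f : Fin n → MvPolynomial (Fin n) ℂ)

/-- The ideal of `B` generated by the maximal ideal of the point `u` of `U`. -/
noncomputable def fibreIdeal (u : Fin n → ℂ) : Ideal (MvPolynomial (Fin n) ℂ) :=
  Ideal.span (Set.range fun i => f i - C (u i))

theorem zeroLocus_fibreIdeal (u : Fin n → ℂ) :
    zeroLocus ℂ (fibreIdeal f u) = toMap f ⁻¹' {u} := by
  ext v
  simp [fibreIdeal, zeroLocus_span, funext_iff, toMap, sub_eq_zero]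

/-- At a point where the Jacobian does not vanish, the fibre is unramified. -/
theorem pointIdeal_le_sup_sq {v : Fin n → ℂ} (h : eval v (jacobian f) ≠ 0) :
    pointIdeal v ≤ fibreIdeal f (toMap f v) ⊔ pointIdeal v ^ 2 := by
  set K := fibreIdeal f (toMap f v) ⊔ pointIdeal v ^ 2
  set M : Matrix (Fin n) (Fin n) ℂ := (eval v).mapMatrix (Matrix.of fun i j => pderiv j (f i))
    with hM
  have hdet : M.det ≠ 0 := by rwa [jacobian, RingHom.map_det] at h
  have hlin : ∀ i, ∑ j, C (M i j) * (X j - C (v j)) ∈ K := by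
    intro i
    have h1 : f i - C (eval v (f i)) ∈ K :=
      Ideal.mem_sup_left (Ideal.subset_span ⟨i, rfl⟩)
    have h2 := Ideal.mem_sup_right (S := fibreIdeal f (toMap f v))
      (sub_linear_mem_pointIdeal_sq v (f i))
    simpa [hM] using sub_mem h1 h2
  -- Inverting the Jacobian matrix at `v` recovers the coordinates from the linear parts of the
  -- `fᵢ`.
  have hX : ∀ k, X k - C (v k) ∈ K := by
    intro k
    have h1 : ∑ i, C (M⁻¹ k i) * ∑ j, C (M i j) * (X j - C (v j)) ∈ K :=
      sum_mem fun i _ => Ideal.mul_mem_left _ _ (hlin i)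
    convert h1 using 1
    simp only [Finset.mul_sum]
    rw [Finset.sum_comm]
    simp only [← mul_assoc, ← Finset.sum_mul, ← C_mul, ← map_sum]
    have h2 : M⁻¹ * M = 1 := Matrix.nonsing_inv_mul M (isUnit_iff_ne_zero.2 hdet)
    have h3 : ∀ j, ∑ i, M⁻¹ k i * M i j = (1 : Matrix (Fin n) (Fin n) ℂ) k j := fun j => by
      rw [← h2, Matrix.mul_apply]
    simp [h3, Matrix.one_apply]
  intro p hp
  have h1 := Ideal.mem_sup_right (S := fibreIdeal f (toMap f v)) (sub_linear_mem_pointIdeal_sq v p)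
  rw [mem_pointIdeal.1 hp, C_0, sub_zero] at h1
  have h2 : ∑ j, C (eval v (pderiv j p)) * (X j - C (v j)) ∈ K :=
    sum_mem fun j _ => Ideal.mul_mem_left _ _ (hX j)
  simpa using add_mem h1 h2

theorem vanishingIdeal_finset (s : Finset (Fin n → ℂ)) :
    vanishingIdeal ℂ (s : Set (Fin n → ℂ)) = ∏ v ∈ s, pointIdeal v := by
  rw [Ideal.prod_eq_iInf_of_pairwise_isCoprime]
  · ext p
    simp [mem_vanishingIdeal_iff]
  · intro v _ v' _ hne
    refine Ideal.isCoprime_of_isMaximal fun h => hne ?_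
    funext j
    have h1 : X j - C (v j) ∈ pointIdeal v' := h ▸ X_sub_C_mem_pointIdeal v j
    rw [mem_pointIdeal] at h1
    simpa [sub_eq_zero, eq_comm] using h1

/-- If the Jacobian has no zero on a finite fibre, the fibre is reduced. -/
theorem vanishingIdeal_fibre_le {u : Fin n → ℂ} (s : Finset (Fin n → ℂ))
    (hs : toMap f ⁻¹' {u} = s) (h : ∀ v ∈ s, eval v (jacobian f) ≠ 0) :
    vanishingIdeal ℂ (s : Set (Fin n → ℂ)) ≤ fibreIdeal f u := by
  set M := fibreIdeal f u
  set I := vanishingIdeal ℂ (s : Set (Fin n → ℂ)) with hI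
  -- Modulo `M` every point ideal of the fibre is idempotent, hence so is their product `I`; by the
  -- Nullstellensatz it is also nilpotent, hence zero.
  let π := Ideal.mapHom (Ideal.Quotient.mk M)
  have hπM : π M = ⊥ := Ideal.map_quotient_self M
  have hπ : ∀ v ∈ s, π (pointIdeal v) = π (pointIdeal v) ^ 2 := by
    intro v hv
    refine le_antisymm ?_ (Ideal.pow_le_self two_ne_zero)
    have hu : toMap f v = u := by
      have : v ∈ toMap f ⁻¹' {u} := hs ▸ hv
      exact this
    have h1 := Ideal.map_mono (f := Ideal.Quotient.mk M) (pointIdeal_le_sup_sq f (h v hv))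
    rw [hu, Ideal.map_sup, Ideal.map_quotient_self, bot_sup_eq, Ideal.map_pow] at h1
    exact h1
  have hidem : IsIdempotentElem (π I) := by
    rw [IsIdempotentElem, hI, vanishingIdeal_finset, map_prod, ← pow_two, ← Finset.prod_pow]
    exact Finset.prod_congr rfl fun v hv => (hπ v hv).symm
  have hrad : I ≤ M.radical := by
    rw [hI, ← hs, ← zeroLocus_fibreIdeal, vanishingIdeal_zeroLocus_eq_radical]
  obtain ⟨N, hN⟩ := Ideal.exists_pow_le_of_le_radical_of_fg hrad (IsNoetherian.noetherian I)
  have h1 : π I = ⊥ := by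
    rw [← hidem.pow_succ_eq N, ← map_pow, eq_bot_iff, ← hπM]
    exact Ideal.map_mono ((Ideal.pow_le_pow_right (Nat.le_succ N)).trans hN)
  have h2 := Ideal.map_le_iff_le_comap.1 (le_of_eq h1 : Ideal.map (Ideal.Quotient.mk M) I ≤ ⊥)
  rwa [← RingHom.ker_eq_comap_bot, Ideal.mk_ker] at h2

/-- A module-finite extension of a domain has rank at most the number of elements generating it
modulo a proper ideal. -/
theorem finrank_le_card_of_le_span_sup {A B : Type*} [CommRing A] [IsDomain A] [IsNoetherianRing A]
    [CommRing B] [IsDomain B] [Algebra A B] [FaithfulSMul A B] [Module.Finite A B]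
    {ι : Type*} [Fintype ι] (b : ι → B) (m : Ideal A) (hm : m ≠ ⊤)
    (h : (⊤ : Submodule A B) ≤ Submodule.span A (Set.range b) ⊔ m • ⊤) :
    Module.finrank A B ≤ Fintype.card ι := by
  -- Nakayama: some `r ≡ 1` modulo `m` maps `B` into the span, injectively because `r ≠ 0`.
  obtain ⟨r, hr, hrb⟩ := Submodule.exists_sub_one_mem_and_smul_le_of_fg_of_le_sup
    Module.Finite.fg_top le_rfl h
  have hr0 : r ≠ 0 := by
    rintro rfl
    exact hm ((Ideal.eq_top_iff_one _).2 (by simpa using hr))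
  let φ : B →ₗ[A] Submodule.span A (Set.range b) :=
    (LinearMap.lsmul A B r).codRestrict _ fun x =>
      hrb (Submodule.smul_mem_pointwise_smul x r ⊤ trivial)
  have hφ : Function.Injective φ := by
    intro x y hxy
    have h1 : r • x = r • y := congrArg Subtype.val hxy
    rw [Algebra.smul_def, Algebra.smul_def] at h1
    exact mul_left_cancel₀
      ((map_ne_zero_iff _ (FaithfulSMul.algebraMap_injective A B)).2 hr0) h1
  exact (LinearMap.finrank_le_finrank_of_injective hφ).trans (finrank_range_le_card b)

variable [Module.Finite (baseRing f) (MvPolynomial (Fin n) ℂ)]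

/-- A fibre on which the Jacobian has no zero has at least `r` points. -/
theorem degree_le_encard_fibre (v₀ : Fin n → ℂ)
    (h : ∀ v, toMap f v = toMap f v₀ → eval v (jacobian f) ≠ 0) :
    (degree f : ℕ∞) ≤ (toMap f ⁻¹' {toMap f v₀}).encard := by
  classical
  by_cases hfin : (toMap f ⁻¹' {toMap f v₀}).Finite
  swap
  · rw [Set.Infinite.encard_eq hfin]
    exact le_top
  obtain ⟨s, hs⟩ := hfin.exists_finset_coe
  have hle := vanishingIdeal_fibre_le f s hs.symm fun v hv => h v (by
    have : v ∈ toMap f ⁻¹' {toMap f v₀} := hs ▸ hv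
    exact this)
  rw [← hs, Set.encard_coe_eq_coe_finsetCard, Nat.cast_le]
  choose b hb1 hb0 using exists_eval_eq_ite s
  let a : Fin n → baseRing f := fun i =>
    ⟨f i, Algebra.subset_adjoin ⟨i, rfl⟩⟩ - algebraMap ℂ _ (toMap f v₀ i)
  let m : Ideal (baseRing f) := Ideal.span (Set.range a)
  have hmM : m.map (algebraMap (baseRing f) (MvPolynomial (Fin n) ℂ)) =
      fibreIdeal f (toMap f v₀) := by
    rw [Ideal.map_span, ← Set.range_comp]
    rfl
  have hm : m ≠ ⊤ := by
    intro hm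
    have h1 : fibreIdeal f (toMap f v₀) ≤ pointIdeal v₀ := by
      rw [fibreIdeal, Ideal.span_le]
      rintro _ ⟨i, rfl⟩
      exact mem_pointIdeal.2 (by simp [toMap])
    rw [← hmM, hm, Ideal.map_top] at h1
    have h2 : (1 : MvPolynomial (Fin n) ℂ) ∈ pointIdeal v₀ := h1 trivial
    rw [mem_pointIdeal] at h2
    simp at h2
  -- The interpolating polynomials generate `B` modulo the fibre ideal, because the fibre is
  -- reduced: `x - y` vanishes on it.
  have hle' : (⊤ : Submodule (baseRing f) (MvPolynomial (Fin n) ℂ)) ≤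
      Submodule.span (baseRing f) (Set.range fun v : s => b v) ⊔ m • ⊤ := by
    intro x _
    rw [Ideal.smul_top_eq_map, hmM]
    let y := ∑ v : s, algebraMap ℂ (baseRing f) (eval v.1 x) • b v
    have hy : y ∈ Submodule.span (baseRing f) (Set.range fun v : s => b v) :=
      sum_mem fun v _ => Submodule.smul_mem _ _ (Submodule.subset_span ⟨v, rfl⟩)
    have hxy : x - y ∈ fibreIdeal f (toMap f v₀) := by
      refine hle (mem_vanishingIdeal_iff.2 fun v hv => ?_)
      have hy' : y = ∑ v : s, C (eval v.1 x) * b v := rfl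
      rw [aeval_eq_eval, map_sub, sub_eq_zero, hy', map_sum,
        Finset.sum_eq_single (⟨v, hv⟩ : s)]
      · simp [hb1]
      · intro v' _ hne
        rw [map_mul, hb0 v' v hv (fun h => hne (Subtype.ext h.symm)), mul_zero]
      · simp
    have := Submodule.add_mem_sup hy
      (show x - y ∈ (fibreIdeal f (toMap f v₀)).restrictScalars (baseRing f) from hxy)
    rwa [add_sub_cancel] at this
  have := finrank_le_card_of_le_span_sup (fun v : s => b v) m hm hle'
  rwa [Fintype.card_coe] at this

/-- The branch locus is the image of the ramification locus (within the image of `f`). -/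
theorem toMap_mem_branchLocus_iff {v₀ : Fin n → ℂ} :
    toMap f v₀ ∈ branchLocus f ↔ ∃ v ∈ ramLocus f, toMap f v = toMap f v₀ := by
  constructor
  · intro h
    by_contra! h'
    exact absurd (degree_le_encard_fibre f v₀ fun v hv hJ => h' v hJ hv) (not_le.2 h)
  · rintro ⟨v, hv, hvv⟩
    rw [← hvv]
    exact encard_fibre_lt_degree f hv

end EtaleFibres

/-! ### Ramified primes and the equivalences. -/

section RamifiedPrimes

variable {n : ℕ} (f : Fin n → MvPolynomial (Fin n) ℂ)
  [Module.Finite (baseRing f) (MvPolynomial (Fin n) ℂ)]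

theorem pow_dvd_iff_le_ramIndex {Q : MvPolynomial (Fin n) ℂ} (hQ : Prime Q) {P : baseRing f}
    (hP : Prime P) (h : Q ∣ (P : MvPolynomial (Fin n) ℂ)) (k : ℕ) :
    Q ^ k ∣ (P : MvPolynomial (Fin n) ℂ) ↔ k ≤ ramIndex f (Ideal.span {Q}) := by
  rw [ramIndex_eq_multiplicity f Q hQ.irreducible P hP.ne_zero (under_eq_span_of_dvd f hQ hP h)]
  exact (FiniteMultiplicity.of_not_isUnit hQ.not_isUnit
    (by simpa using hP.ne_zero)).pow_dvd_iff_le_multiplicity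

/-- The multiplicity of a height-one prime in the Jacobian is less than its ramification index. -/
theorem not_pow_ramIndex_dvd_jacobian {Q : MvPolynomial (Fin n) ℂ} (hQ : Prime Q) :
    ¬ Q ^ ramIndex f (Ideal.span {Q}) ∣ jacobian f := by
  obtain ⟨P, hP, hQP⟩ := exists_prime_under_eq_span f hQ
  have h : Q ∣ (P : MvPolynomial (Fin n) ℂ) :=
    (mem_under_span_iff f).1 (hQP ▸ Ideal.mem_span_singleton_self P)
  have hk := pow_dvd_iff_le_ramIndex f hQ hP h
  refine not_pow_dvd_jacobian f hQ hP ?_ ((hk _).2 le_rfl) fun h' => ?_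
  · have := (hk 1).1 (by simpa using h)
    omega
  · have := (hk _).1 h'
    omega

/-- Any prime of `B` has a power not dividing `J`; a variable serves. -/
theorem jacobian_ne_zero (hn : 0 < n) : jacobian f ≠ 0 := fun h =>
  not_pow_ramIndex_dvd_jacobian f (X_prime (i := (⟨0, hn⟩ : Fin n))) (h ▸ dvd_zero _)

/-- The ramified height-one primes are those containing the Jacobian. -/
theorem dvd_jacobian_iff {Q : MvPolynomial (Fin n) ℂ} (hQ : Prime Q) :
    Q ∣ jacobian f ↔ 1 < ramIndex f (Ideal.span {Q}) := by
  constructor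
  · intro h
    by_contra! hle
    exact not_pow_ramIndex_dvd_jacobian f hQ ((pow_dvd_pow Q hle).trans (by simpa using h))
  · intro h
    obtain ⟨P, hP, hQP⟩ := exists_prime_under_eq_span f hQ
    have hd : Q ∣ (P : MvPolynomial (Fin n) ℂ) :=
      (mem_under_span_iff f).1 (hQP ▸ Ideal.mem_span_singleton_self P)
    exact dvd_jacobian_of_sq_dvd f hQ hP ((pow_dvd_iff_le_ramIndex f hQ hP hd 2).2 h)

theorem finite_specOneRam (hn : 0 < n) : (specOneRam f).Finite := by
  classical
  refine (((UniqueFactorizationMonoid.factors (jacobian f)).toFinset.image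
    fun x => Ideal.span {x}).finite_toSet).subset ?_
  rintro q ⟨hq, hram⟩
  obtain ⟨Q, hQ, rfl⟩ := exists_prime_span_eq_of_mem_specOne hq
  obtain ⟨x, hx, hQx⟩ := UniqueFactorizationMonoid.exists_mem_factors_of_dvd
    (jacobian_ne_zero f hn) hQ.irreducible ((dvd_jacobian_iff f hQ).2 hram)
  exact Finset.mem_coe.2 (Finset.mem_image.2
    ⟨x, Multiset.mem_toFinset.2 hx, (Ideal.span_singleton_eq_span_singleton.2 hQx).symm⟩)

theorem under_mem_specOne {q : Ideal (MvPolynomial (Fin n) ℂ)}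
    (hq : q ∈ specOne (MvPolynomial (Fin n) ℂ)) :
    q.under (baseRing f) ∈ specOne (baseRing f) := by
  obtain ⟨Q, hQ, rfl⟩ := exists_prime_span_eq_of_mem_specOne hq
  obtain ⟨P, hP, h⟩ := exists_prime_under_eq_span f hQ
  rw [h]
  exact span_singleton_mem_specOne hP

/-- Uniform ramification: over a height-one prime of `A`, either all height-one primes of `B` are
ramified or none is. -/
def RamifiesUniformly : Prop :=
  ∀ p ∈ specOne (baseRing f),
    (∃ q₀ ∈ specOne (MvPolynomial (Fin n) ℂ),
      q₀.under (baseRing f) = p ∧ 1 < ramIndex f q₀) →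
    ∀ q ∈ specOne (MvPolynomial (Fin n) ℂ), q.under (baseRing f) = p → 1 < ramIndex f q

/-- The irreducible factors of `P` generate the primes over `(P)`, with ramification indices as
multiplicities. -/
theorem ramifiesUniformly_iff_irreducible :
    RamifiesUniformly f ↔ ∀ P : baseRing f, Irreducible P →
      Squarefree (P : MvPolynomial (Fin n) ℂ) ∨
      ∀ Q : MvPolynomial (Fin n) ℂ, Irreducible Q →
        Q ∣ (P : MvPolynomial (Fin n) ℂ) → Q ^ 2 ∣ (P : MvPolynomial (Fin n) ℂ) := by
  constructor
  · intro H P hP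
    have hP' := hP.prime
    by_cases hsq : Squarefree (P : MvPolynomial (Fin n) ℂ)
    · exact Or.inl hsq
    refine Or.inr fun Q hQ hQP => ?_
    have hP0 : (P : MvPolynomial (Fin n) ℂ) ≠ 0 := by simpa using hP.ne_zero
    rw [squarefree_iff_irreducible_sq_not_dvd_of_ne_zero hP0] at hsq
    push Not at hsq
    obtain ⟨Q₀, hQ₀, hd₀⟩ := hsq
    have hd₀' : Q₀ ∣ (P : MvPolynomial (Fin n) ℂ) := (dvd_mul_right _ _).trans hd₀
    rw [pow_dvd_iff_le_ramIndex f hQ.prime hP' hQP]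
    refine H (Ideal.span {P}) (span_singleton_mem_specOne hP') ⟨Ideal.span {Q₀},
      span_singleton_mem_specOne hQ₀.prime, under_eq_span_of_dvd f hQ₀.prime hP' hd₀', ?_⟩
      _ (span_singleton_mem_specOne hQ.prime) (under_eq_span_of_dvd f hQ.prime hP' hQP)
    exact (pow_dvd_iff_le_ramIndex f hQ₀.prime hP' hd₀' 2).1 (by rwa [pow_two])
  · rintro H p hp ⟨q₀, hq₀, rfl, hram⟩ q hq hqp
    obtain ⟨P, hP, hpP⟩ := exists_prime_span_eq_of_mem_specOne hp
    obtain ⟨Q₀, hQ₀, rfl⟩ := exists_prime_span_eq_of_mem_specOne hq₀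
    obtain ⟨Q, hQ, rfl⟩ := exists_prime_span_eq_of_mem_specOne hq
    rw [hpP] at hqp
    have hd₀ := (mem_under_span_iff f).1 (hpP ▸ Ideal.mem_span_singleton_self P)
    have hd := (mem_under_span_iff f).1 (hqp ▸ Ideal.mem_span_singleton_self P)
    have hsq := (pow_dvd_iff_le_ramIndex f hQ₀ hP hd₀ 2).2 hram
    rcases H P hP.irreducible with h | h
    · exact absurd (h Q₀ (by rwa [← pow_two])) hQ₀.not_isUnit
    · exact (pow_dvd_iff_le_ramIndex f hQ hP hd 2).1 (h Q hQ.irreducible hd)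

/-! ### The products over ramified primes, and contraction to `A`. -/

section Products

variable {f} {g : Ideal (MvPolynomial (Fin n) ℂ) → MvPolynomial (Fin n) ℂ}

omit [Module.Finite (baseRing f) (MvPolynomial (Fin n) ℂ)] in
theorem IsRepresentatives.prime (hg : IsRepresentatives g) {q : Ideal (MvPolynomial (Fin n) ℂ)}
    (hq : q ∈ specOne (MvPolynomial (Fin n) ℂ)) : Prime (g q) := by
  have h := hq.1
  rw [← hg q hq] at h
  refine (Ideal.span_singleton_prime fun h0 => ?_).1 h
  refine Ideal.ne_bot_of_height_eq_one hq.2 ?_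
  rw [← hg q hq, h0, Ideal.span_singleton_eq_bot]

theorem IsRepresentatives.associated (hg : IsRepresentatives g) {Q : MvPolynomial (Fin n) ℂ}
    (hQ : Prime Q) : Associated (g (Ideal.span {Q})) Q :=
  Ideal.span_singleton_eq_span_singleton.1 (hg _ (span_singleton_mem_specOne hQ))

theorem pow_dvd_ramPowProd (hn : 0 < n) (hg : IsRepresentatives g) {Q : MvPolynomial (Fin n) ℂ}
    (hQ : Prime Q) (hram : 1 < ramIndex f (Ideal.span {Q})) {k : ℕ}
    (hk : k ≤ ramIndex f (Ideal.span {Q})) : Q ^ k ∣ ramPowProd f g := by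
  rw [ramPowProd, finprod_mem_eq_finite_toFinset_prod _ (finite_specOneRam f hn)]
  have h1 : Q ^ k ∣ g (Ideal.span {Q}) ^ ramIndex f (Ideal.span {Q}) :=
    (pow_dvd_pow Q hk).trans (pow_dvd_pow_of_dvd (hg.associated hQ).symm.dvd _)
  refine h1.trans (Finset.dvd_prod_of_mem (fun q => g q ^ ramIndex f q) ?_)
  exact (Set.Finite.mem_toFinset _).2 ⟨span_singleton_mem_specOne hQ, hram⟩

theorem one_lt_ramIndex_of_dvd_ramPowProd (hn : 0 < n) (hg : IsRepresentatives g)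
    {Q : MvPolynomial (Fin n) ℂ} (hQ : Prime Q) (h : Q ∣ ramPowProd f g) :
    1 < ramIndex f (Ideal.span {Q}) := by
  rw [ramPowProd, finprod_mem_eq_finite_toFinset_prod _ (finite_specOneRam f hn)] at h
  obtain ⟨q, hq, hd⟩ := (Prime.dvd_finsetProd_iff hQ _).1 h
  obtain ⟨hq1, hram⟩ := (Set.Finite.mem_toFinset _).1 hq
  have h1 := hQ.associated_of_dvd (hg.prime hq1) (hQ.dvd_of_dvd_pow hd)
  rwa [Ideal.span_singleton_eq_span_singleton.2 h1, hg q hq1]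

/-- Prime factors of `J` are ramified and occur in it fewer than `e_Q` times. -/
theorem jacobian_dvd_ramPowProd (hn : 0 < n) (hg : IsRepresentatives g) :
    jacobian f ∣ ramPowProd f g := by
  refine dvd_of_forall_prime_pow_dvd (jacobian_ne_zero f hn) fun Q hQ k hk => ?_
  rcases Nat.eq_zero_or_pos k with rfl | hk0
  · simp
  refine pow_dvd_ramPowProd hn hg hQ
    ((dvd_jacobian_iff f hQ).1 ((dvd_pow_self Q hk0.ne').trans hk)) ?_
  by_contra! hlt
  exact not_pow_ramIndex_dvd_jacobian f hQ ((pow_dvd_pow Q hlt.le).trans hk)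

theorem ramProd_dvd_ramPowProd (hn : 0 < n) : ramProd f g ∣ ramPowProd f g := by
  rw [ramProd, ramPowProd, finprod_mem_eq_finite_toFinset_prod _ (finite_specOneRam f hn),
    finprod_mem_eq_finite_toFinset_prod _ (finite_specOneRam f hn)]
  refine Finset.prod_dvd_prod_of_dvd _ _ fun q hq => dvd_pow_self _ ?_
  have := ((Set.Finite.mem_toFinset _).1 hq).2
  omega

theorem dvd_ramProd (hn : 0 < n) {q : Ideal (MvPolynomial (Fin n) ℂ)} (hq : q ∈ specOneRam f) :
    g q ∣ ramProd f g := by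
  rw [ramProd, finprod_mem_eq_finite_toFinset_prod _ (finite_specOneRam f hn)]
  exact Finset.dvd_prod_of_mem g ((Set.Finite.mem_toFinset _).2 hq)

theorem ramifiesUniformly_of_ramPowProd_mem (hn : 0 < n) (hg : IsRepresentatives g)
    (h : ramPowProd f g ∈ baseRing f) : RamifiesUniformly f := by
  rintro p hp ⟨q₀, hq₀, rfl, hram⟩ q hq hqp
  obtain ⟨Q₀, hQ₀, rfl⟩ := exists_prime_span_eq_of_mem_specOne hq₀
  obtain ⟨Q, hQ, rfl⟩ := exists_prime_span_eq_of_mem_specOne hq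
  refine one_lt_ramIndex_of_dvd_ramPowProd hn hg hQ ?_
  have h1 : (⟨_, h⟩ : baseRing f) ∈ (Ideal.span {Q₀}).under (baseRing f) :=
    (mem_under_span_iff f).2 (by simpa using pow_dvd_ramPowProd hn hg hQ₀ hram hram.le)
  rw [← hqp] at h1
  exact (mem_under_span_iff f).1 h1

/-- A common prime factor would lie over both `(P)` and `(P')`. -/
theorem isRelPrime_coe {P P' : baseRing f} (hP : Prime P) (hP' : Prime P')
    (h : Ideal.span {P} ≠ Ideal.span {P'}) :
    IsRelPrime (P : MvPolynomial (Fin n) ℂ) (P' : MvPolynomial (Fin n) ℂ) := by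
  refine WfDvdMonoid.isRelPrime_of_no_irreducible_factors
    (fun h0 => hP.ne_zero (by simpa using h0.1)) fun Q hQ hd hd' => h ?_
  rw [← under_eq_span_of_dvd f hQ.prime hP hd, under_eq_span_of_dvd f hQ.prime hP' hd']

theorem isRelPrime_of_span_ne {R : Type*} [CommRing R] [IsDomain R] {x y : R} (hx : Prime x)
    (hy : Prime y) (h : Ideal.span {x} ≠ Ideal.span {y}) : IsRelPrime x y :=
  (hx.irreducible.isRelPrime_iff_not_dvd).2 fun hd =>
    h (Ideal.span_singleton_eq_span_singleton.2 (hx.associated_of_dvd hy hd))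

/-- Under uniform ramification, `∏ Q ^ e_Q` is associated to an element of `A` which divides every
element of `A` divisible by all the ramified `Q`. -/
theorem RamifiesUniformly.exists_associated (H : RamifiesUniformly f) (hn : 0 < n)
    (hg : IsRepresentatives g) :
    ∃ d : baseRing f, Associated (d : MvPolynomial (Fin n) ℂ) (ramPowProd f g) ∧
      ∀ c : baseRing f, (∀ q ∈ specOneRam f, g q ∣ (c : MvPolynomial (Fin n) ℂ)) → d ∣ c := by
  classical
  have hγ : ∀ p : Ideal (baseRing f), ∃ x, p ∈ specOne (baseRing f) →
      Prime x ∧ p = Ideal.span {x} := fun p => by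
    by_cases hp : p ∈ specOne (baseRing f)
    · obtain ⟨x, hx⟩ := exists_prime_span_eq_of_mem_specOne hp
      exact ⟨x, fun _ => hx⟩
    · exact ⟨0, fun h => absurd h hp⟩
  choose γ hγ using hγ
  let S := (finite_specOneRam f hn).toFinset
  have hS : ∀ {q}, q ∈ S ↔ q ∈ specOneRam f := (Set.Finite.mem_toFinset _)
  let T := S.image fun q => q.under (baseRing f)
  have hT : ∀ p ∈ T, p ∈ specOne (baseRing f) := by
    intro p hp
    obtain ⟨q, hq, rfl⟩ := Finset.mem_image.1 hp
    exact under_mem_specOne f (hS.1 hq).1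
  have hne : ∀ p ∈ T, ∀ p' ∈ T, p ≠ p' → Ideal.span {γ p} ≠ Ideal.span {γ p'} := by
    intro p hp p' hp' hpp
    rwa [← (hγ p (hT p hp)).2, ← (hγ p' (hT p' hp')).2]
  -- The witness takes once each prime of `A` below a ramified prime. Uniform ramification is needed
  -- only for it to divide `R`: all its prime factors in `B` must be ramified.
  refine ⟨∏ p ∈ T, γ p, associated_of_dvd_dvd ?_ ?_, fun c hc => ?_⟩
  · rw [SubmonoidClass.coe_finsetProd]
    refine Finset.prod_dvd_of_isRelPrime (fun p hp p' hp' hpp =>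
      isRelPrime_coe (hγ p (hT p hp)).1 (hγ p' (hT p' hp')).1 (hne p hp p' hp' hpp)) ?_
    intro p hp
    obtain ⟨q₀, hq₀, hqp⟩ := Finset.mem_image.1 hp
    obtain ⟨hγp, hpγ⟩ := hγ p (hT p hp)
    refine dvd_of_forall_prime_pow_dvd (by simpa using hγp.ne_zero) fun Q hQ k hk => ?_
    rcases Nat.eq_zero_or_pos k with rfl | hk0
    · simp
    have hd := (dvd_pow_self Q hk0.ne').trans hk
    refine pow_dvd_ramPowProd hn hg hQ ?_ ((pow_dvd_iff_le_ramIndex f hQ hγp hd k).1 hk)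
    exact H p (hT p hp) ⟨q₀, (hS.1 hq₀).1, hqp, (hS.1 hq₀).2⟩ _ (span_singleton_mem_specOne hQ)
      ((under_eq_span_of_dvd f hQ hγp hd).trans hpγ.symm)
  · rw [ramPowProd, finprod_mem_eq_finite_toFinset_prod _ (finite_specOneRam f hn)]
    refine Finset.prod_dvd_of_isRelPrime (fun q hq q' hq' hqq => IsRelPrime.pow ?_)
      fun q hq => ?_
    · have h1 := (hS.1 hq).1
      have h2 := (hS.1 hq').1
      refine isRelPrime_of_span_ne (hg.prime h1) (hg.prime h2) ?_
      rwa [hg q h1, hg q' h2]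
    · have h1 := (hS.1 hq).1
      have hqT : q.under (baseRing f) ∈ T := Finset.mem_image_of_mem _ hq
      obtain ⟨hγp, hpγ⟩ := hγ _ (hT _ hqT)
      have hd : g q ∣ (γ (q.under (baseRing f)) : MvPolynomial (Fin n) ℂ) := by
        have hmem := Ideal.mem_span_singleton_self (γ (q.under (baseRing f)))
        rwa [← hpγ, ← hg q h1, mem_under_span_iff, hg q h1] at hmem
      refine ((pow_dvd_iff_le_ramIndex f (hg.prime h1) hγp hd _).2 ?_).trans
        (coe_dvd_of_dvd f (Finset.dvd_prod_of_mem γ hqT))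
      rw [hg q h1]
  · refine Finset.prod_dvd_of_isRelPrime (fun p hp p' hp' hpp =>
      isRelPrime_of_span_ne (hγ p (hT p hp)).1 (hγ p' (hT p' hp')).1 (hne p hp p' hp' hpp)) ?_
    intro p hp
    obtain ⟨q, hq, rfl⟩ := Finset.mem_image.1 hp
    have h1 := (hS.1 hq).1
    rw [← Ideal.mem_span_singleton, ← (hγ _ (hT _ hp)).2, ← hg q h1, mem_under_span_iff]
    exact hc q (hS.1 hq)

/-- Stated for general `F` to cover both `J` and `∏ Q`. -/
theorem RamifiesUniformly.contractsTo (H : RamifiesUniformly f) (hn : 0 < n)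
    (hg : IsRepresentatives g) {F : MvPolynomial (Fin n) ℂ} (hF : F ∣ ramPowProd f g)
    (hF' : ∀ q ∈ specOneRam f, g q ∣ F) : ContractsTo f F (ramPowProd f g) := by
  obtain ⟨d, ⟨u, hu⟩, hd⟩ := H.exists_associated hn hg
  -- Units of `B` are constants, so associates of elements of `A` stay in `A`.
  obtain ⟨z, -, hz⟩ := MvPolynomial.isUnit_iff_eq_C_of_isReduced.1 u.isUnit
  obtain ⟨z', -, hz'⟩ := MvPolynomial.isUnit_iff_eq_C_of_isReduced.1 u⁻¹.isUnit
  have hR : ramPowProd f g ∈ baseRing f := by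
    rw [← hu, hz]
    exact mul_mem d.2 ((baseRing f).algebraMap_mem z)
  ext x
  rw [SetLike.mem_coe, Submodule.mem_span_singleton, Set.mem_inter_iff, SetLike.mem_coe,
    Ideal.mem_span_singleton, SetLike.mem_coe]
  constructor
  · rintro ⟨hFx, hx⟩
    obtain ⟨y, hy⟩ := hd ⟨x, hx⟩ fun q hq => (hF' q hq).trans hFx
    refine ⟨y * algebraMap ℂ _ z', ?_⟩
    have hy' : x = d * y := congrArg Subtype.val hy
    change (y : MvPolynomial (Fin n) ℂ) * C z' * ramPowProd f g = x
    rw [← hz', ← hu, hy']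
    calc (y : MvPolynomial (Fin n) ℂ) * ↑u⁻¹ * (d * u) = d * y * (↑u⁻¹ * u) := by ring
      _ = d * y := by rw [Units.inv_mul, mul_one]
  · rintro ⟨c, rfl⟩
    exact ⟨hF.mul_left _, mul_mem c.2 hR⟩

omit [Module.Finite (baseRing f) (MvPolynomial (Fin n) ℂ)] in
theorem ContractsTo.mem {F R : MvPolynomial (Fin n) ℂ} (h : ContractsTo f F R) :
    R ∈ baseRing f := by
  have h1 : R ∈ (Submodule.span (baseRing f) {R} : Set (MvPolynomial (Fin n) ℂ)) :=
    Submodule.mem_span_singleton_self R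
  rw [← h] at h1
  exact h1.2

end Products

/-! ### Zero sets and images of the ramification locus. -/

/-- The zero sets of two height-one primes of `B` over the same prime of `A` have the same image
under `f`. -/
theorem exists_eval_eq_zero_of_under_eq {Q Q₀ : MvPolynomial (Fin n) ℂ}
    (h : (Ideal.span {Q₀}).under (baseRing f) = (Ideal.span {Q}).under (baseRing f))
    {v : Fin n → ℂ} (hv : eval v Q = 0) :
    ∃ v₀, eval v₀ Q₀ = 0 ∧ toMap f v₀ = toMap f v := by
  have hmax : (pointIdeal v).IsMaximal := inferInstance
  -- Lying-over above `(Q₀)` gives a maximal ideal with the same contraction as that of `v`: a point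
  -- of `Z(Q₀)` in the fibre of `v`.
  obtain ⟨N, hN, hNp, hNc⟩ := Ideal.exists_ideal_over_prime_of_isIntegral
    ((pointIdeal v).under (baseRing f)) (Ideal.span {Q₀}) (by
      change (Ideal.span {Q₀}).under (baseRing f) ≤ _
      rw [h]
      exact Ideal.comap_mono
        ((Ideal.span_singleton_le_iff_mem _).2 (mem_pointIdeal.2 hv)))
  have hm : (N.comap (algebraMap (baseRing f) (MvPolynomial (Fin n) ℂ))).IsMaximal := by
    rw [hNc]
    exact Ideal.isMaximal_comap_of_isIntegral_of_isMaximal (pointIdeal v)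
  obtain ⟨v₀, rfl⟩ := eq_vanishingIdeal_singleton_of_isMaximal ℂ
    (Ideal.isMaximal_of_isIntegral_of_isMaximal_comap N hm)
  refine ⟨v₀, mem_pointIdeal.1 (hN (Ideal.mem_span_singleton_self Q₀)), funext fun i => ?_⟩
  let c : baseRing f := ⟨f i, Algebra.subset_adjoin ⟨i, rfl⟩⟩ - algebraMap ℂ _ (toMap f v i)
  have hc : (c : MvPolynomial (Fin n) ℂ) = f i - C (toMap f v i) := rfl
  have h1 : c ∈ (pointIdeal v).under (baseRing f) := by
    change (c : MvPolynomial (Fin n) ℂ) ∈ pointIdeal v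
    rw [mem_pointIdeal, hc]
    simp [toMap]
  rw [← hNc] at h1
  have h2 : (c : MvPolynomial (Fin n) ℂ) ∈ pointIdeal v₀ := h1
  rw [mem_pointIdeal, hc, map_sub, eval_C, sub_eq_zero] at h2
  exact h2

theorem exists_prime_dvd_of_eval_eq_zero {F : MvPolynomial (Fin n) ℂ} (hF : F ≠ 0)
    {v : Fin n → ℂ} (hv : eval v F = 0) : ∃ Q, Prime Q ∧ Q ∣ F ∧ eval v Q = 0 := by
  induction F using UniqueFactorizationMonoid.induction_on_prime with
  | h₁ => exact absurd rfl hF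
  | h₂ x hx => exact absurd hv (hx.map (eval v)).ne_zero
  | h₃ a p ha hp ih =>
    rw [map_mul, mul_eq_zero] at hv
    rcases hv with hv | hv
    · exact ⟨p, hp, dvd_mul_right _ _, hv⟩
    · obtain ⟨Q, hQ, hd, hQv⟩ := ih ha hv
      exact ⟨Q, hQ, hd.mul_left _, hQv⟩

/-- A prime polynomial divides every polynomial vanishing on its zero set. -/
theorem dvd_of_forall_eval_eq_zero {Q F : MvPolynomial (Fin n) ℂ} (hQ : Prime Q)
    (h : ∀ v, eval v Q = 0 → eval v F = 0) : Q ∣ F := by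
  have hQp : (Ideal.span {Q}).IsPrime := (Ideal.span_singleton_prime hQ.ne_zero).2 hQ
  rw [← Ideal.mem_span_singleton,
    ← MvPolynomial.IsPrime.vanishingIdeal_zeroLocus (K := ℂ) (Ideal.span {Q}),
    mem_vanishingIdeal_iff]
  intro v hv
  rw [aeval_eq_eval]
  refine h v ?_
  rw [← aeval_eq_eval]
  exact hv Q (Ideal.mem_span_singleton_self Q)

/-- A zero of `J` lies on a ramified `Q₀`; the prime `P` below vanishes on its whole fibre, so other
fibre points lie on primes over `(P)`, ramified as well. Conversely, every point of `Z(Q)` shares a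
fibre with a point of `Z(Q₀)`, so `J` vanishes on `Z(Q)` and `Q` divides `J`. -/
theorem ramifiesUniformly_iff_disjoint (hn : 0 < n) :
    RamifiesUniformly f ↔
      toMap f '' ramLocus f ∩ toMap f '' (ramLocus f)ᶜ = ∅ := by
  constructor
  · intro H
    rw [Set.eq_empty_iff_forall_notMem]
    rintro _ ⟨⟨v₀, hv₀, rfl⟩, ⟨v, hv, hvv⟩⟩
    obtain ⟨Q₀, hQ₀, hd₀, hQv₀⟩ :=
      exists_prime_dvd_of_eval_eq_zero (jacobian_ne_zero f hn) hv₀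
    obtain ⟨P, hP, hQP⟩ := exists_prime_under_eq_span f hQ₀
    have hQ₀P := (mem_under_span_iff f).1 (hQP ▸ Ideal.mem_span_singleton_self P)
    have hPv : eval v (P : MvPolynomial (Fin n) ℂ) = 0 := by
      obtain ⟨z, hz⟩ := hQ₀P
      rw [eval_eq_of_toMap_eq hvv, hz, map_mul, hQv₀, zero_mul]
    obtain ⟨Q, hQ, hd, hQv⟩ := exists_prime_dvd_of_eval_eq_zero
      (F := (P : MvPolynomial (Fin n) ℂ)) (by simpa using hP.ne_zero) hPv
    have hram := H _ (span_singleton_mem_specOne hP) ⟨_, span_singleton_mem_specOne hQ₀, hQP,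
      (dvd_jacobian_iff f hQ₀).1 hd₀⟩ _ (span_singleton_mem_specOne hQ)
      (under_eq_span_of_dvd f hQ hP hd)
    obtain ⟨z, hz⟩ := (dvd_jacobian_iff f hQ).2 hram
    refine hv ?_
    change eval v (jacobian f) = 0
    rw [hz, map_mul, hQv, zero_mul]
  · rintro H p hp ⟨q₀, hq₀, rfl, hram⟩ q hq hqp
    obtain ⟨Q₀, hQ₀, rfl⟩ := exists_prime_span_eq_of_mem_specOne hq₀
    obtain ⟨Q, hQ, rfl⟩ := exists_prime_span_eq_of_mem_specOne hq
    rw [← dvd_jacobian_iff f hQ]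
    refine dvd_of_forall_eval_eq_zero hQ fun v hv => ?_
    by_contra hJ
    obtain ⟨v₀, hv₀, hvv⟩ := exists_eval_eq_zero_of_under_eq f hqp.symm hv
    obtain ⟨z, hz⟩ := (dvd_jacobian_iff f hQ₀).2 hram
    refine Set.eq_empty_iff_forall_notMem.1 H (toMap f v)
      ⟨⟨v₀, ?_, hvv⟩, ⟨v, hJ, rfl⟩⟩
    change eval v₀ (jacobian f) = 0
    rw [hz, map_mul, hv₀, zero_mul]

theorem preimage_branchLocus_eq_iff :
    toMap f ⁻¹' branchLocus f = ramLocus f ↔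
      toMap f '' ramLocus f ∩ toMap f '' (ramLocus f)ᶜ = ∅ := by
  rw [Set.eq_empty_iff_forall_notMem]
  constructor
  · rintro h _ ⟨⟨v₀, hv₀, rfl⟩, ⟨v, hv, hvv⟩⟩
    refine hv ?_
    rw [← h]
    exact (toMap_mem_branchLocus_iff f).2 ⟨v₀, hv₀, hvv.symm⟩
  · intro h
    ext v
    rw [Set.mem_preimage, toMap_mem_branchLocus_iff]
    constructor
    · rintro ⟨v₀, hv₀, hvv⟩
      by_contra hv
      exact h (toMap f v) ⟨⟨v₀, hv₀, hvv⟩, ⟨v, hv, rfl⟩⟩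
    · exact fun hv => ⟨v, hv, rfl⟩

end RamifiedPrimes
end PolyExt

theorem mainTheorem7 {n : ℕ} (hn : 0 < n) (b a : Fin n → ℕ)
    (f : Fin n → MvPolynomial (Fin n) ℂ) (hf : PolyExt.IsFiniteGraded b a f)
    (g : Ideal (MvPolynomial (Fin n) ℂ) → MvPolynomial (Fin n) ℂ)
    (hg : PolyExt.IsRepresentatives g) :
    (PolyExt.specOneRam f).Finite ∧
    List.TFAE [
      PolyExt.IsWellRamified f g,
      PolyExt.ContractsTo f (PolyExt.ramProd f g) (PolyExt.ramPowProd f g),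
      PolyExt.ramPowProd f g ∈ PolyExt.baseRing f,
      ∀ p ∈ PolyExt.specOne (PolyExt.baseRing f),
        (∃ q₀ ∈ PolyExt.specOne (MvPolynomial (Fin n) ℂ),
          q₀.under (PolyExt.baseRing f) = p ∧ 1 < PolyExt.ramIndex f q₀) →
        ∀ q ∈ PolyExt.specOne (MvPolynomial (Fin n) ℂ),
          q.under (PolyExt.baseRing f) = p → 1 < PolyExt.ramIndex f q,
      ∀ P : PolyExt.baseRing f, Irreducible P →
        Squarefree (P : MvPolynomial (Fin n) ℂ) ∨
        ∀ Q : MvPolynomial (Fin n) ℂ, Irreducible Q →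
          Q ∣ (P : MvPolynomial (Fin n) ℂ) → Q ^ 2 ∣ (P : MvPolynomial (Fin n) ℂ),
      PolyExt.toMap f ⁻¹' PolyExt.branchLocus f = PolyExt.ramLocus f,
      PolyExt.toMap f '' PolyExt.ramLocus f ∩ PolyExt.toMap f '' (PolyExt.ramLocus f)ᶜ = ∅] := by
  have := hf.finite
  refine ⟨PolyExt.finite_specOneRam f hn, ?_⟩
  tfae_have 1 → 3 := fun h => PolyExt.ContractsTo.mem h
  tfae_have 2 → 3 := fun h => PolyExt.ContractsTo.mem h
  tfae_have 3 → 4 := fun h => PolyExt.ramifiesUniformly_of_ramPowProd_mem hn hg h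
  tfae_have 4 → 1 := fun h => PolyExt.RamifiesUniformly.contractsTo h hn hg
    (PolyExt.jacobian_dvd_ramPowProd hn hg) fun q hq =>
      (PolyExt.dvd_jacobian_iff f (hg.prime hq.1)).2 (by rw [hg q hq.1]; exact hq.2)
  tfae_have 4 → 2 := fun h => PolyExt.RamifiesUniformly.contractsTo h hn hg
    (PolyExt.ramProd_dvd_ramPowProd hn) fun q hq => PolyExt.dvd_ramProd hn hq
  tfae_have 4 ↔ 5 := PolyExt.ramifiesUniformly_iff_irreducible f
  tfae_have 4 ↔ 7 := PolyExt.ramifiesUniformly_iff_disjoint f hn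
  tfae_have 6 ↔ 7 := PolyExt.preimage_branchLocus_eq_iff f
  tfae_finish
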